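/- Let $M>0$. Two points $p_0,p_1\in\mathbb R^2$ are called non-antipodal if the origin does not lie on the closed segment from $p_0$ to $p_1$ (so $p_0,p_1\neq 0$); let $\mathcal N\subset\mathbb R^2\times\mathbb R^2$ be the open set of non-antipodal pairs. A Kepler arc of energy $E$ from $p_0$ to $p_1$ is a continuous curve $z:[0,T]\to\mathbb R^2$, $T>0$, with $z(0)=p_0$, $z(T)=p_1$ and $$z''(s)=-M\frac{z(s)}{\|z(s)\|^3},\qquad \tfrac12\|z'(s)\|^2-E-\frac{M}{\|z(s)\|}=0$$ for all $s\in[0,T]$ with $z(s)\ne0$; the arc may be regularized: collisions $z(s)=0$ are allowed if they are isolated and the curve is then reflected back along its path, i.e. $z(s+\sigma)=z(s-\sigma)$ for all small $\sigma>0$. For $(p_0,p_1)\in\mathcal N$ such an arc is topologically non-trivial if it is not homotopic, with fixed end points and within $\mathbb R^2\setminus\{0\}$, to the line segment from $p_0$ to $p_1$ (an arc through the origin counts as non-trivial). Then for every $(p_0,p_1)\in\mathcal N$ and every $E>0$ there is exactly one topologically non-trivial, possibly regularized, Kepler arc $z_I(\cdot;p_0,p_1;E):[0,T]\to\mathbb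 R^2$ of energy $E$ from $p_0$ to $p_1$ (both $T$ and the curve are unique). Moreover its Jacobi length $$L_I(z_I)=\int_0^T\|z_I'(s)\|\sqrt{E+\frac{M}{\|z_I(s)\|}}\,ds$$ is finite (the integral converges) and $$L_I(z_I)=\sqrt E\,\bigl(\|p_0\|+\|p_1\|\bigr)+\frac{M}{\sqrt E}\Bigl(F(p_0,p_1;E)-\log\frac{M}{2E}\Bigr),$$ where, for every $E>0$, $F(\cdot,\cdot;E)$ is of class $C^2$ on $\mathcal N$, and $F$ is $C^2$-bounded as $E\to\infty$, uniformly for $(p_0,p_1)$ in compact subsets of $\mathcal N$: for every compact $K\subset\mathcal N$ there are constants $C$ and $E_0>0$ such that for all $E\ge E_0$ the function $F(\cdot,\cdot;E)$ and its derivatives in $(p_0,p_1)$ of first and second order are bounded by $C$ on $K$. -/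

import Mathlib

open Set Filter Topology

/-- The Euclidean plane. -/
abbrev Plane := EuclideanSpace ℝ (Fin 2)

/-- The punctured plane `ℝ² \ {0}`, with the subspace topology. -/
abbrev PuncturedPlane := {z : Plane // z ≠ 0}

/-- `p` and `q` are not antipodal: the origin does not belong to the closed segment from `p` to `q`
(in particular both points are different from the origin). -/
def NonAntipodal (p q : Plane) : Prop := (0 : Plane) ∉ segment ℝ p q

/-- The velocity `z'` of a curve on `[0, T]` (one-sided at the end points). -/
noncomputable def velocity (T : ℝ) (z : ℝ → Plane) (s : ℝ) : Plane :=
  derivWithin z (Icc 0 T) s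

/-- `z : [0, T] → ℝ²` is a (possibly regularized) solution of energy `E` of the Kepler problem with
mass parameter `M` from `p₀` to `p₁`: it is continuous, it satisfies Newton's equation and the energy
relation at all times at which it is not at the centre, and at a collision with the centre it is
continued by the elastic bounce to which the Levi-Civita regularization leads: collisions are
isolated, and after a collision the curve is reflected back along the path on which it came. Only the
values of `z` on `[0, T]` matter. -/
structure IsKeplerArc (M E : ℝ) (p₀ p₁ : Plane) (T : ℝ) (z : ℝ → Plane) : Prop where
  pos : 0 < T
  start : z 0 = p₀
  finish : z T = p₁
  cont : ContinuousOn z (Icc 0 T)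
  differentiable : ∀ s ∈ Icc 0 T, z s ≠ 0 → DifferentiableWithinAt ℝ z (Icc 0 T) s
  newton : ∀ s ∈ Icc 0 T, z s ≠ 0 →
    HasDerivWithinAt (velocity T z) (-(M / ‖z s‖ ^ 3) • z s) (Icc 0 T) s
  energy : ∀ s ∈ Icc 0 T, z s ≠ 0 → 1 / 2 * ‖velocity T z s‖ ^ 2 - E - M / ‖z s‖ = 0
  bounce : ∀ s ∈ Icc 0 T, z s = 0 → ∀ᶠ σ in 𝓝[>] (0 : ℝ), z (s + σ) ≠ 0 ∧ z (s + σ) = z (s - σ)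

/-- For non-antipodal `p₀`, `p₁`, the curve `z : [0, T] → ℝ²` from `p₀` to `p₁` is topologically
non-trivial: it is not homotopic, with fixed end points and inside the punctured plane, to the line
segment from `p₀` to `p₁`. A curve that passes through the origin is not a path of the punctured
plane, so it is non-trivial. -/
def TopologicallyNontrivial (p₀ p₁ : Plane) (T : ℝ) (z : ℝ → Plane) : Prop :=
  ¬ ∃ (x y : PuncturedPlane) (α β : Path x y),
      (∀ t : unitInterval, (α t : Plane) = z (t * T)) ∧
      (∀ t : unitInterval, (β t : Plane) = AffineMap.lineMap p₀ p₁ (t : ℝ)) ∧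
      α.Homotopic β

/-- The integrand of the Jacobi length. -/
noncomputable def jacobiIntegrand (M E T : ℝ) (z : ℝ → Plane) (s : ℝ) : ℝ :=
  ‖velocity T z s‖ * √(E + M / ‖z s‖)

/-- The Jacobi length `∫₀ᵀ ‖z'(s)‖ √(E + M / ‖z(s)‖) ds`. -/
noncomputable def jacobiLength (M E T : ℝ) (z : ℝ → Plane) : ℝ :=
  ∫ s in (0 : ℝ)..T, jacobiIntegrand M E T z s

/-- The set of pairs of non-antipodal points, an open subset of `ℝ² × ℝ²`. -/
def nonAntipodalPairs : Set (Plane × Plane) := {x | NonAntipodal x.1 x.2}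

/-! ### The regular part of the length formula -/

open scoped ComplexConjugate

/-! The proof is the Levi-Civita regularization. Identify the plane with ℂ, write z = w² and replace
the time s by x with ds/dx = |w|²/ω, where E = 2ω². The Kepler problem at energy E becomes the
linear equation w'' = w with |w'|² - |w|² = ε, ε = M/E. So every arc is the square of a motion a
cosh x + b sinh x, and a collision is the only zero of w, about which w is odd; hence the bounce
(`orbit_isKeplerArc`, `IsKeplerArc.exists_isRegularizedBy`).

Fix a root a of p₀. The motion ends, at x = θ, at one of the two roots of p₁. Non-antipodality means
that these are not orthogonal to a, and by lifting homotopies through squaring, non-triviality means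
⟨a, w(θ)⟩ < 0 (`IsRegularizedBy.topologicallyNontrivial_iff`). This selects the root. The energy
relation is then quadratic in cosh θ, with the admissible solution ε cosh θ = d + √(d² + εr + ε²),
where d is `halfAngleTerm` and r = ‖p₀‖ + ‖p₁‖. This determines θ, and then b.

In the new variable the length is 2√E ∫|w'|² = √E ((r cosh θ + 2d) / sinh θ + εθ). Splitting coth θ
= 1 + (coth θ - 1) isolates √E r, and θ = log(ε exp θ / 2) - log(ε / 2) isolates the logarithm.
Because d > 0, what remains is C² in (ε, p₀, p₁) even at ε = 0 (`contDiffAt_lengthRemainder`), so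
compactness of [0, 1] × K bounds it uniformly as E → ∞. -/

/-- For square roots `w₀`, `w₁` of two points of the plane, the absolute value of `⟪w₀, w₁⟫`. -/
noncomputable def halfAngleTerm (x : Plane × Plane) : ℝ :=
  √((‖x.1‖ * ‖x.2‖ + inner ℝ x.1 x.2) / 2)

/-- The discriminant `d² + ε r + ε²` of the quadratic equation for `cosh θ`. -/
noncomputable def arcDiscr (y : ℝ × Plane × Plane) : ℝ :=
  halfAngleTerm y.2 ^ 2 + y.1 * (‖y.2.1‖ + ‖y.2.2‖) + y.1 ^ 2

/-- The number `ε cosh θ`, where `θ` is the hyperbolic angle of the non-trivial arc. -/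
noncomputable def arcCosh (y : ℝ × Plane × Plane) : ℝ :=
  halfAngleTerm y.2 + √(arcDiscr y)

/-- The number `ε sinh θ`, where `θ` is the hyperbolic angle of the non-trivial arc. -/
noncomputable def arcSinh (y : ℝ × Plane × Plane) : ℝ :=
  √(arcCosh y ^ 2 - y.1 ^ 2)

/-- The regular part of the Jacobi length, as a function of `ε = M / E` and the end points. -/
noncomputable def lengthRemainder (y : ℝ × Plane × Plane) : ℝ :=
  (‖y.2.1‖ + ‖y.2.2‖) * y.1 / (arcSinh y * (arcCosh y + arcSinh y)) +
    2 * halfAngleTerm y.2 / arcSinh y + Real.log ((arcCosh y + arcSinh y) / 2)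

theorem NonAntipodal.left_ne_zero {p q : Plane} (h : NonAntipodal p q) : p ≠ 0 := by
  rintro rfl; exact h (left_mem_segment ℝ _ _)

theorem NonAntipodal.right_ne_zero {p q : Plane} (h : NonAntipodal p q) : q ≠ 0 := by
  rintro rfl; exact h (right_mem_segment ℝ _ _)

/-- Otherwise ‖q‖p + ‖p‖q vanishes, and normalizing its coefficients exhibits the origin as a point
of the segment. -/
theorem NonAntipodal.norm_mul_norm_add_inner_pos {p q : Plane} (h : NonAntipodal p q) :
    0 < ‖p‖ * ‖q‖ + inner ℝ p q := by
  have hp := norm_pos_iff.2 h.left_ne_zero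
  have hq := norm_pos_iff.2 h.right_ne_zero
  by_contra! hle
  have h1 : ‖‖q‖ • p + ‖p‖ • q‖ ^ 2 = 2 * ‖p‖ * ‖q‖ * (‖p‖ * ‖q‖ + inner ℝ p q) := by
    rw [norm_add_sq_real, norm_smul, norm_smul, inner_smul_left, inner_smul_right]
    simp; ring
  have h2 : ‖q‖ • p + ‖p‖ • q = 0 := by
    have : ‖‖q‖ • p + ‖p‖ • q‖ ^ 2 ≤ 0 := by
      rw [h1]; exact mul_nonpos_of_nonneg_of_nonpos (by positivity) hle
    simpa using le_antisymm this (by positivity)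
  refine h ⟨‖q‖ / (‖p‖ + ‖q‖), ‖p‖ / (‖p‖ + ‖q‖), by positivity, by positivity,
    by field_simp; ring, ?_⟩
  have : (‖q‖ / (‖p‖ + ‖q‖)) • p + (‖p‖ / (‖p‖ + ‖q‖)) • q =
      (‖p‖ + ‖q‖)⁻¹ • (‖q‖ • p + ‖p‖ • q) := by
    rw [smul_add, smul_smul, smul_smul]; congr 2 <;> ring
  rw [this, h2, smul_zero]

section
variable {y : ℝ × Plane × Plane}

theorem halfAngleTerm_pos {x : Plane × Plane} (hx : x ∈ nonAntipodalPairs) :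
    0 < halfAngleTerm x :=
  Real.sqrt_pos.2 (half_pos (NonAntipodal.norm_mul_norm_add_inner_pos hx))

theorem arcDiscr_pos (h0 : 0 ≤ y.1) (hy : y.2 ∈ nonAntipodalPairs) : 0 < arcDiscr y := by
  have := halfAngleTerm_pos hy
  unfold arcDiscr; positivity

theorem self_lt_arcCosh (h0 : 0 ≤ y.1) (hy : y.2 ∈ nonAntipodalPairs) : y.1 < arcCosh y := by
  have := halfAngleTerm_pos hy
  have : y.1 ≤ √(arcDiscr y) := Real.le_sqrt_of_sq_le <| by
    unfold arcDiscr
    have : 0 ≤ y.1 * (‖y.2.1‖ + ‖y.2.2‖) := by positivity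
    nlinarith
  unfold arcCosh; linarith

theorem sq_lt_arcCosh_sq (h0 : 0 ≤ y.1) (hy : y.2 ∈ nonAntipodalPairs) :
    0 < arcCosh y ^ 2 - y.1 ^ 2 := by
  have := self_lt_arcCosh h0 hy
  nlinarith

theorem arcSinh_pos (h0 : 0 ≤ y.1) (hy : y.2 ∈ nonAntipodalPairs) : 0 < arcSinh y :=
  Real.sqrt_pos.2 (sq_lt_arcCosh_sq h0 hy)

theorem arcCosh_pos (h0 : 0 ≤ y.1) (hy : y.2 ∈ nonAntipodalPairs) : 0 < arcCosh y :=
  h0.trans_lt (self_lt_arcCosh h0 hy)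

/-- Non-antipodality keeps every norm, root, denominator and logarithm away from its singularity,
also at ε = 0. Including that limit value is what makes the bounds uniform for large E. -/
theorem contDiffAt_lengthRemainder (h0 : 0 ≤ y.1) (hy : y.2 ∈ nonAntipodalPairs) :
    ContDiffAt ℝ 2 lengthRemainder y := by
  have h1 : ContDiffAt ℝ 2 (fun y : ℝ × Plane × Plane => y.2.1) y := by fun_prop
  have h2 : ContDiffAt ℝ 2 (fun y : ℝ × Plane × Plane => y.2.2) y := by fun_prop
  have n1 := h1.norm ℝ hy.left_ne_zero
  have n2 := h2.norm ℝ hy.right_ne_zero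
  have e : ContDiffAt ℝ 2 (fun y : ℝ × Plane × Plane => y.1) y := by fun_prop
  have d : ContDiffAt ℝ 2 (fun y : ℝ × Plane × Plane => halfAngleTerm y.2) y :=
    (((n1.mul n2).add (h1.inner ℝ h2)).div_const 2).sqrt
      (half_pos (NonAntipodal.norm_mul_norm_add_inner_pos hy)).ne'
  have D : ContDiffAt ℝ 2 arcDiscr y := ((d.pow 2).add (e.mul (n1.add n2))).add (e.pow 2)
  have c : ContDiffAt ℝ 2 arcCosh y := d.add (D.sqrt (arcDiscr_pos h0 hy).ne')
  have s : ContDiffAt ℝ 2 arcSinh y :=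
    ((c.pow 2).sub (e.pow 2)).sqrt (sq_lt_arcCosh_sq h0 hy).ne'
  have hc := arcCosh_pos h0 hy
  have hs := arcSinh_pos h0 hy
  exact ((((n1.add n2).mul e).div (s.mul (c.add s)) (by positivity)).add
    ((contDiffAt_const.mul d).div s hs.ne')).add
    (((c.add s).div_const 2).log (by positivity))

end

/-! ### Uniform bounds for partial derivatives -/

/-- The partial iterated derivatives of a `C^n` function of a parameter and a variable are
bounded on products of compact sets. -/
theorem exists_bound_norm_iteratedFDeriv_prodMk {V G : Type*} [NormedAddCommGroup V]
    [NormedSpace ℝ V] [NormedAddCommGroup G] [NormedSpace ℝ G] {f : ℝ × V → G} {n : ℕ}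
    {I : Set ℝ} {K : Set V} (hI : IsCompact I) (hK : IsCompact K)
    (hf : ∀ t ∈ I, ∀ x ∈ K, ContDiffAt ℝ n f (t, x)) :
    ∃ C, ∀ t ∈ I, ∀ x ∈ K, ∀ k ≤ n, ‖iteratedFDeriv ℝ k (fun x => f (t, x)) x‖ ≤ C := by
  have key : ∀ t ∈ I, ∀ x ∈ K, ∀ k ≤ n,
      ‖iteratedFDeriv ℝ k (fun x => f (t, x)) x‖ ≤ ‖iteratedFDeriv ℝ k f (t, x)‖ := by
    intro t ht x hx k hk
    have hev := (hf t ht x hx).eventually (by simp)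
    obtain ⟨U, hU, hUo, hxU⟩ := eventually_nhds_iff.1 hev
    -- The inclusion x ↦ (t, x) is only affine; translating by (t, 0) leaves the linear map `inr`,
    -- of norm at most 1.
    let a : ℝ × V := (t, 0)
    let f' : ℝ × V → G := fun y => f (y + a)
    let U' : Set (ℝ × V) := (fun y => y + a) ⁻¹' U
    have hU'o : IsOpen U' := hUo.preimage (by fun_prop)
    have hcd : ContDiffOn ℝ n f' U' := fun y hy =>
      ((hU (y + a) hy).comp y (contDiffAt_id.add contDiffAt_const)).contDiffWithinAt
    let g := ContinuousLinearMap.inr ℝ ℝ V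
    have hgo : IsOpen (g ⁻¹' U') := hU'o.preimage g.continuous
    have hgx : g x ∈ U' := by simpa [U', g, a] using hxU
    have h := g.iteratedFDerivWithin_comp_right hcd hU'o.uniqueDiffOn hgo.uniqueDiffOn hgx
      (i := k) (by exact_mod_cast hk)
    rw [iteratedFDerivWithin_of_isOpen k hgo hgx, iteratedFDerivWithin_of_isOpen k hU'o hgx,
      iteratedFDeriv_comp_add_right] at h
    have e1 : f' ∘ g = fun x => f (t, x) := by ext x; simp [f', g, a]
    have e2 : g x + a = (t, x) := by simp [g, a]
    rw [e1, e2] at h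
    rw [h]
    refine (ContinuousMultilinearMap.norm_compContinuousLinearMap_le _ _).trans ?_
    refine mul_le_of_le_one_right (norm_nonneg _) (Finset.prod_le_one (by simp) fun _ _ => ?_)
    exact ContinuousLinearMap.norm_inr_le_one ℝ ℝ V
  have bd : ∀ k : ℕ, ∃ C, k ≤ n → ∀ y ∈ I ×ˢ K, ‖iteratedFDeriv ℝ k f y‖ ≤ C := by
    intro k
    by_cases hk : k ≤ n
    · obtain ⟨C, hC⟩ := (hI.prod hK).exists_bound_of_continuousOn (f := iteratedFDeriv ℝ k f)
        fun y hy => ((hf y.1 hy.1 y.2 hy.2).continuousAt_iteratedFDeriv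
          (by exact_mod_cast hk)).continuousWithinAt
      exact ⟨C, fun _ => hC⟩
    · exact ⟨0, fun h => absurd h hk⟩
  choose C hC using bd
  refine ⟨∑ k ∈ Finset.range (n + 1), |C k|, fun t ht x hx k hk => ?_⟩
  calc _ ≤ _ := key t ht x hx k hk
    _ ≤ C k := hC k hk (t, x) ⟨ht, hx⟩
    _ ≤ |C k| := le_abs_self _
    _ ≤ _ := Finset.single_le_sum (f := fun k => |C k|) (fun _ _ => abs_nonneg _)
      (Finset.mem_range.2 (by omega))

/-! ### Hyperbolic motions and Kepler's equation -/

/-- The identification of the complex numbers with the Euclidean plane. -/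
noncomputable def complexPlane : ℂ ≃ₗᵢ[ℝ] Plane := Complex.orthonormalBasisOneI.repr

/-- The hyperbolic motion `a cosh x + b sinh x`, the solution of `w'' = w` with `w 0 = a` and
`w' 0 = b`. Its derivative is `hyperbolicMotion b a`. -/
noncomputable def hyperbolicMotion (a b : ℂ) (x : ℝ) : ℂ :=
  a * (Real.cosh x : ℂ) + b * (Real.sinh x : ℂ)

/-- The physical time along the square of a hyperbolic motion (Kepler's equation). -/
noncomputable def keplerTime (a b : ℂ) (ω x : ℝ) : ℝ :=
  ((Complex.normSq a + Complex.normSq b) / 2 * (Real.sinh (2 * x) / 2) +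
    (a.re * b.re + a.im * b.im) * ((Real.cosh (2 * x) - 1) / 2) -
    (Complex.normSq b - Complex.normSq a) / 2 * x) / ω

section Motion

variable {a b : ℂ} {x y ω : ℝ}

@[simp] theorem hyperbolicMotion_zero : hyperbolicMotion a b 0 = a := by
  simp [hyperbolicMotion]

@[simp] theorem keplerTime_zero : keplerTime a b ω 0 = 0 := by
  simp [keplerTime]

theorem hyperbolicMotion_re :
    (hyperbolicMotion a b x).re = a.re * Real.cosh x + b.re * Real.sinh x := by
  simp [hyperbolicMotion, -Complex.ofReal_cosh, -Complex.ofReal_sinh]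

theorem hyperbolicMotion_im :
    (hyperbolicMotion a b x).im = a.im * Real.cosh x + b.im * Real.sinh x := by
  simp [hyperbolicMotion, -Complex.ofReal_cosh, -Complex.ofReal_sinh]

theorem conj_hyperbolicMotion :
    conj (hyperbolicMotion a b x) = hyperbolicMotion (conj a) (conj b) x := by
  simp [hyperbolicMotion, -Complex.ofReal_cosh, -Complex.ofReal_sinh]

theorem hyperbolicMotion_add :
    hyperbolicMotion a b (x + y) =
      hyperbolicMotion (hyperbolicMotion a b x) (hyperbolicMotion b a x) y := by
  simp only [hyperbolicMotion, Real.cosh_add, Real.sinh_add, Complex.ofReal_add,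
    Complex.ofReal_mul]
  ring

theorem hasDerivAt_hyperbolicMotion (a b : ℂ) (x : ℝ) :
    HasDerivAt (hyperbolicMotion a b) (hyperbolicMotion b a x) x := by
  have h := ((Real.hasDerivAt_cosh x).ofReal_comp.const_mul a).add
    ((Real.hasDerivAt_sinh x).ofReal_comp.const_mul b)
  convert! h using 1
  simp only [hyperbolicMotion]; ring

theorem continuous_hyperbolicMotion (a b : ℂ) : Continuous (hyperbolicMotion a b) :=
  continuous_iff_continuousAt.2 fun x => (hasDerivAt_hyperbolicMotion a b x).continuousAt

theorem normSq_hyperbolicMotion_sub (a b : ℂ) (x : ℝ) :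
    Complex.normSq (hyperbolicMotion b a x) - Complex.normSq (hyperbolicMotion a b x) =
      Complex.normSq b - Complex.normSq a := by
  simp only [Complex.normSq_apply, hyperbolicMotion_re, hyperbolicMotion_im]
  linear_combination (b.re ^ 2 + b.im ^ 2 - a.re ^ 2 - a.im ^ 2) * Real.cosh_sq_sub_sinh_sq x

theorem hasDerivAt_keplerTime (a b : ℂ) (ω x : ℝ) :
    HasDerivAt (keplerTime a b ω) (Complex.normSq (hyperbolicMotion a b x) / ω) x := by
  have h2 : HasDerivAt (fun x : ℝ => 2 * x) 2 x := by simpa using (hasDerivAt_id x).const_mul 2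
  have h := ((((h2.sinh.div_const 2).const_mul
    ((Complex.normSq a + Complex.normSq b) / 2)).add
    (((h2.cosh.sub_const 1).div_const 2).const_mul (a.re * b.re + a.im * b.im))).sub
    ((hasDerivAt_id x).const_mul ((Complex.normSq b - Complex.normSq a) / 2))).div_const ω
  convert! h using 1
  simp only [Complex.normSq_apply, hyperbolicMotion_re, hyperbolicMotion_im, Real.cosh_two_mul,
    Real.sinh_two_mul]
  congr 1
  linear_combination ((a.re ^ 2 + a.im ^ 2 - b.re ^ 2 - b.im ^ 2) / 2) * Real.cosh_sq_sub_sinh_sq x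

theorem hyperbolicMotion_swap_ne_zero (h : Complex.normSq a < Complex.normSq b) (x : ℝ) :
    hyperbolicMotion b a x ≠ 0 := by
  intro h0
  have h1 := normSq_hyperbolicMotion_sub a b x
  rw [h0, map_zero] at h1
  linarith [Complex.normSq_nonneg (hyperbolicMotion a b x)]

/-- Restarted at a zero, the motion is a nonzero velocity times sinh. -/
theorem hyperbolicMotion_zero_unique (h : Complex.normSq a < Complex.normSq b)
    (hx : hyperbolicMotion a b x = 0) (hy : hyperbolicMotion a b y = 0) : x = y := by
  have h1 : hyperbolicMotion a b (x + (y - x)) = 0 := by simpa using hy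
  rw [hyperbolicMotion_add, hx] at h1
  have h2 := hyperbolicMotion_swap_ne_zero h x
  simp only [hyperbolicMotion, zero_mul, zero_add, mul_eq_zero, Complex.ofReal_eq_zero,
    Real.sinh_eq_zero] at h1
  rcases h1 with h1 | h1
  · exact absurd h1 h2
  · linarith

theorem hyperbolicMotion_reflect (hx : hyperbolicMotion a b x = 0) (y : ℝ) :
    hyperbolicMotion a b (x + y) = -hyperbolicMotion a b (x - y) := by
  rw [sub_eq_add_neg, hyperbolicMotion_add, hyperbolicMotion_add, hx]
  simp [hyperbolicMotion]

/-- |w|² is even about a zero of w, so the sum on the left has zero derivative in `y`. -/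
theorem keplerTime_reflect (hx : hyperbolicMotion a b x = 0) (y : ℝ) :
    keplerTime a b ω (x + y) + keplerTime a b ω (x - y) = 2 * keplerTime a b ω x := by
  have hd : ∀ y, HasDerivAt (fun y => keplerTime a b ω (x + y) + keplerTime a b ω (x - y)) 0 y := by
    intro y
    have h := ((hasDerivAt_keplerTime a b ω (x + y)).comp_const_add x y).add
      ((hasDerivAt_keplerTime a b ω (x - y)).comp_const_sub x y)
    convert! h using 1
    rw [hyperbolicMotion_reflect hx, Complex.normSq_neg]; ring
  have h := is_const_of_deriv_eq_zero (fun y => (hd y).differentiableAt) (fun y => (hd y).deriv) y 0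
  simp only [add_zero, sub_zero] at h
  rw [h]; ring

/-- The derivative |w|²/ω is positive except possibly at one collision, where the two half-lines are
glued. -/
theorem strictMono_keplerTime (hω : 0 < ω) (h : Complex.normSq a < Complex.normSq b) :
    StrictMono (keplerTime a b ω) := by
  have hc : Continuous (keplerTime a b ω) :=
    continuous_iff_continuousAt.2 fun x => (hasDerivAt_keplerTime a b ω x).continuousAt
  have hpos : ∀ x, hyperbolicMotion a b x ≠ 0 → 0 < deriv (keplerTime a b ω) x := fun x hx => by
    rw [(hasDerivAt_keplerTime a b ω x).deriv]
    exact div_pos (Complex.normSq_pos.2 hx) hω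
  by_cases hz : ∃ c, hyperbolicMotion a b c = 0
  · obtain ⟨c, hz⟩ := hz
    refine StrictMonoOn.Iic_union_Ici (a := c)
      (strictMonoOn_of_deriv_pos (convex_Iic c) hc.continuousOn fun x hx => hpos x fun h0 => ?_)
      (strictMonoOn_of_deriv_pos (convex_Ici c) hc.continuousOn fun x hx => hpos x fun h0 => ?_)
    · rw [interior_Iic] at hx
      exact (ne_of_lt hx) (hyperbolicMotion_zero_unique h h0 hz)
    · rw [interior_Ici] at hx
      exact (ne_of_gt hx) (hyperbolicMotion_zero_unique h h0 hz)
  · push Not at hz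
    exact strictMono_of_deriv_pos fun x => hpos x (hz x)

theorem tendsto_keplerTime_atTop (hω : 0 < ω) (h : Complex.normSq a < Complex.normSq b) :
    Tendsto (keplerTime a b ω) atTop atTop := by
  set A := (Complex.normSq a + Complex.normSq b) / 2 with hA
  set B := a.re * b.re + a.im * b.im with hB
  set κ := (Complex.normSq b - Complex.normSq a) / 2 with hκ
  -- Equality here would force b = ±a, against |a| < |b|; the strict gap makes the sinh term
  -- dominate.
  have hAB : |B| < A := by
    rw [abs_lt, hA, hB]
    have ha := Complex.normSq_apply a
    have hb := Complex.normSq_apply b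
    constructor
    · by_contra! hc
      have h1 : (a.re + b.re) ^ 2 + (a.im + b.im) ^ 2 ≤ 0 := by nlinarith
      have h2 : a.re + b.re = 0 := by nlinarith [sq_nonneg (a.re + b.re), sq_nonneg (a.im + b.im)]
      have h3 : a.im + b.im = 0 := by nlinarith [sq_nonneg (a.re + b.re), sq_nonneg (a.im + b.im)]
      rw [ha, hb, eq_neg_of_add_eq_zero_left h2, eq_neg_of_add_eq_zero_left h3] at h
      linarith
    · by_contra! hc
      have h1 : (a.re - b.re) ^ 2 + (a.im - b.im) ^ 2 ≤ 0 := by nlinarith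
      have h2 : a.re - b.re = 0 := by nlinarith [sq_nonneg (a.re - b.re), sq_nonneg (a.im - b.im)]
      have h3 : a.im - b.im = 0 := by nlinarith [sq_nonneg (a.re - b.re), sq_nonneg (a.im - b.im)]
      rw [ha, hb, sub_eq_zero.1 h2, sub_eq_zero.1 h3] at h
      linarith
  have hδ : 0 < A - |B| := sub_pos.2 hAB
  have hlow : ∀ x : ℝ, 0 ≤ x →
      (x * ((A - |B|) / 2 * x - κ)) / ω ≤ keplerTime a b ω x := by
    intro x hx
    unfold keplerTime
    rw [← hA, ← hB, ← hκ]
    gcongr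
    have q := Real.quadratic_le_exp_of_nonneg (show 0 ≤ 2 * x by linarith)
    have e1 : Real.exp (-(2 * x)) ≤ 1 := Real.exp_le_one_iff.2 (by linarith)
    have s1 : x ^ 2 ≤ Real.sinh (2 * x) := by rw [Real.sinh_eq]; nlinarith
    have s2 : Real.cosh (2 * x) - 1 ≤ Real.sinh (2 * x) := by
      rw [Real.sinh_eq, Real.cosh_eq]; linarith
    have s3 : 0 ≤ Real.cosh (2 * x) - 1 := by linarith [Real.one_le_cosh (2 * x)]
    have t1 : -|B| * (Real.cosh (2 * x) - 1) ≤ B * (Real.cosh (2 * x) - 1) :=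
      mul_le_mul_of_nonneg_right (neg_abs_le B) s3
    have t2 : |B| * (Real.cosh (2 * x) - 1) ≤ |B| * Real.sinh (2 * x) :=
      mul_le_mul_of_nonneg_left s2 (abs_nonneg B)
    have t3 := mul_le_mul_of_nonneg_left s1 hδ.le
    linarith
  refine tendsto_atTop_mono' atTop ((eventually_ge_atTop 0).mono hlow) ?_
  refine Tendsto.atTop_div_const hω (tendsto_id.atTop_mul_atTop₀ ?_)
  exact tendsto_atTop_add_const_right _ _ (tendsto_id.const_mul_atTop (by positivity))

theorem keplerTime_neg : keplerTime a b ω (-x) = -keplerTime a (-b) ω x := by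
  simp only [keplerTime, Complex.neg_re, Complex.neg_im, Complex.normSq_neg, mul_neg,
    Real.sinh_neg, Real.cosh_neg]
  ring

theorem surjective_keplerTime (hω : 0 < ω) (h : Complex.normSq a < Complex.normSq b) :
    Function.Surjective (keplerTime a b ω) := by
  refine Continuous.surjective
    (continuous_iff_continuousAt.2 fun x => (hasDerivAt_keplerTime a b ω x).continuousAt)
    (tendsto_keplerTime_atTop hω h) ?_
  have h1 : Tendsto (fun x => -keplerTime a (-b) ω (-x)) atBot atBot :=
    tendsto_neg_atTop_atBot.comp <|
      (tendsto_keplerTime_atTop hω (by rwa [Complex.normSq_neg])).comp tendsto_neg_atBot_atTop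
  refine h1.congr fun x => ?_
  rw [← keplerTime_neg, neg_neg]

/-- The eccentric anomaly is a continuous inverse of the time function. -/
theorem exists_eccentricAnomaly (hω : 0 < ω) (h : Complex.normSq a < Complex.normSq b) :
    ∃ X : ℝ → ℝ, Continuous X ∧ (∀ s, keplerTime a b ω (X s) = s) ∧
      ∀ x, X (keplerTime a b ω x) = x := by
  let e := (strictMono_keplerTime hω h).orderIsoOfSurjective _ (surjective_keplerTime hω h)
  exact ⟨e.symm, e.symm.continuous, fun s => e.apply_symm_apply s, fun x => e.symm_apply_apply x⟩

end Motion

/-! ### Squares of hyperbolic motions solve the Kepler problem -/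

section Orbit

variable {a b : ℂ} {M ω : ℝ} {X : ℝ → ℝ}

theorem hasDerivAt_eccentricAnomaly (hω : 0 < ω) (hX : Continuous X)
    (hSX : ∀ s, keplerTime a b ω (X s) = s) {s : ℝ} (hs : hyperbolicMotion a b (X s) ≠ 0) :
    HasDerivAt X (ω / Complex.normSq (hyperbolicMotion a b (X s))) s := by
  have h := (hasDerivAt_keplerTime a b ω (X s)).of_local_left_inverse hX.continuousAt
    (div_ne_zero (Complex.normSq_pos.2 hs).ne' hω.ne') (.of_forall hSX)
  rwa [inv_div] at h

theorem hasDerivAt_orbit (hω : 0 < ω) (hX : Continuous X)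
    (hSX : ∀ s, keplerTime a b ω (X s) = s) {s : ℝ} (hs : hyperbolicMotion a b (X s) ≠ 0) :
    HasDerivAt (fun s => hyperbolicMotion a b (X s) ^ 2)
      (2 * ω * hyperbolicMotion b a (X s) / hyperbolicMotion (conj a) (conj b) (X s)) s := by
  have h := ((hasDerivAt_hyperbolicMotion a b (X s)).scomp s
    (hasDerivAt_eccentricAnomaly hω hX hSX hs)).pow 2
  refine h.congr_deriv ?_
  have hn := Complex.mul_conj (hyperbolicMotion a b (X s))
  have hc : conj (hyperbolicMotion a b (X s)) ≠ 0 := by simpa using hs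
  simp only [Function.comp_apply, Complex.real_smul, Complex.ofReal_div, ← hn,
    ← conj_hyperbolicMotion]
  field_simp
  push_cast
  ring

/-- Differentiating 2ωw'/w̄ with w'' = w leaves the factor |w|² - |w'|², which is constant and equal
to -M/(2ω²). -/
theorem hasDerivAt_orbit_velocity (hω : 0 < ω)
    (hM : M = 2 * ω ^ 2 * (Complex.normSq b - Complex.normSq a)) (hX : Continuous X)
    (hSX : ∀ s, keplerTime a b ω (X s) = s) {s : ℝ} (hs : hyperbolicMotion a b (X s) ≠ 0) :
    HasDerivAt
      (fun s => 2 * ω * hyperbolicMotion b a (X s) / hyperbolicMotion (conj a) (conj b) (X s))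
      (-(M / ‖hyperbolicMotion a b (X s) ^ 2‖ ^ 3) • hyperbolicMotion a b (X s) ^ 2) s := by
  have hX' := hasDerivAt_eccentricAnomaly hω hX hSX hs
  have hc : hyperbolicMotion (conj a) (conj b) (X s) ≠ 0 := by
    rw [← conj_hyperbolicMotion]; simpa using hs
  have h := (((hasDerivAt_hyperbolicMotion b a (X s)).scomp s hX').const_mul (2 * (ω : ℂ))).div
    ((hasDerivAt_hyperbolicMotion (conj a) (conj b) (X s)).scomp s hX') hc
  refine h.congr_deriv ?_
  have he := normSq_hyperbolicMotion_sub a b (X s)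
  have hn := Complex.mul_conj (hyperbolicMotion a b (X s))
  have hn' := Complex.mul_conj (hyperbolicMotion b a (X s))
  rw [← he] at hM
  rw [norm_pow, ← Complex.normSq_eq_norm_sq, hM]
  simp only [Function.comp_apply, Complex.real_smul, Complex.ofReal_div, Complex.ofReal_neg,
    Complex.ofReal_mul, Complex.ofReal_sub, Complex.ofReal_pow, ← hn, ← hn', Complex.ofReal_ofNat,
    ← conj_hyperbolicMotion] at hc ⊢
  generalize hyperbolicMotion a b (X s) = w at *
  generalize hyperbolicMotion b a (X s) = v at *
  field_simp
  ring

theorem orbit_energy (hω : 0 < ω) {E : ℝ} (hE : E = 2 * ω ^ 2)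
    (hM : M = 2 * ω ^ 2 * (Complex.normSq b - Complex.normSq a)) {x : ℝ}
    (hs : hyperbolicMotion a b x ≠ 0) :
    1 / 2 * ‖2 * ω * hyperbolicMotion b a x / hyperbolicMotion (conj a) (conj b) x‖ ^ 2
      - E - M / ‖hyperbolicMotion a b x ^ 2‖ = 0 := by
  have he := normSq_hyperbolicMotion_sub a b x
  rw [← he] at hM
  simp only [Complex.normSq_eq_norm_sq] at hM
  have hp := norm_pos_iff.2 hs
  rw [← conj_hyperbolicMotion, norm_div, norm_mul, norm_mul, Complex.norm_conj, norm_pow, hM, hE]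
  simp only [Complex.norm_ofNat, Complex.norm_real, Real.norm_eq_abs, abs_of_pos hω]
  field_simp
  ring

theorem orbit_isKeplerArc (hω : 0 < ω) {E T : ℝ} (hT : 0 < T) (hE : E = 2 * ω ^ 2)
    (hM : M = 2 * ω ^ 2 * (Complex.normSq b - Complex.normSq a)) (hM0 : 0 < M) (hX : Continuous X)
    (hSX : ∀ s, keplerTime a b ω (X s) = s) :
    IsKeplerArc M E (complexPlane (hyperbolicMotion a b (X 0) ^ 2))
      (complexPlane (hyperbolicMotion a b (X T) ^ 2)) T
      (fun s => complexPlane (hyperbolicMotion a b (X s) ^ 2)) := by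
  have hab : Complex.normSq a < Complex.normSq b := by
    rw [hM] at hM0; have := pos_of_mul_pos_right hM0 (by positivity); linarith
  have hcw : Continuous fun s => hyperbolicMotion a b (X s) :=
    (continuous_hyperbolicMotion a b).comp hX
  have hz : ∀ {s}, complexPlane (hyperbolicMotion a b (X s) ^ 2) ≠ 0 ↔
      hyperbolicMotion a b (X s) ≠ 0 := by simp
  have hd : ∀ s, hyperbolicMotion a b (X s) ≠ 0 →
      HasDerivAt (fun s => complexPlane (hyperbolicMotion a b (X s) ^ 2)) (complexPlane
        (2 * ω * hyperbolicMotion b a (X s) / hyperbolicMotion (conj a) (conj b) (X s))) s :=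
    fun s hs => complexPlane.toContinuousLinearEquiv.hasFDerivAt.comp_hasDerivAt s
      (hasDerivAt_orbit hω hX hSX hs)
  have hv : ∀ s ∈ Icc 0 T, hyperbolicMotion a b (X s) ≠ 0 →
      velocity T (fun s => complexPlane (hyperbolicMotion a b (X s) ^ 2)) s = complexPlane
        (2 * ω * hyperbolicMotion b a (X s) / hyperbolicMotion (conj a) (conj b) (X s)) :=
    fun s hs h0 => (hd s h0).hasDerivWithinAt.derivWithin (uniqueDiffOn_Icc hT s hs)
  refine ⟨hT, rfl, rfl, ?_, ?_, ?_, ?_, ?_⟩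
  · exact (complexPlane.continuous.comp (hcw.pow 2)).continuousOn
  · exact fun s _ h0 => (hd s (hz.1 h0)).hasDerivWithinAt.differentiableWithinAt
  · intro s hs h0
    have h1 := complexPlane.toContinuousLinearEquiv.hasFDerivAt.comp_hasDerivAt s
      (hasDerivAt_orbit_velocity hω hM hX hSX (hz.1 h0))
    have h2 : -(M / ‖complexPlane (hyperbolicMotion a b (X s) ^ 2)‖ ^ 3) •
        complexPlane (hyperbolicMotion a b (X s) ^ 2) = complexPlane
        (-(M / ‖hyperbolicMotion a b (X s) ^ 2‖ ^ 3) • hyperbolicMotion a b (X s) ^ 2) := by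
      rw [map_smul, LinearIsometryEquiv.norm_map]
    rw [h2]
    refine h1.hasDerivWithinAt.congr_of_eventuallyEq ?_ (hv s hs (hz.1 h0))
    have h3 : ∀ᶠ s in 𝓝 s, hyperbolicMotion a b (X s) ≠ 0 :=
      hcw.continuousAt.eventually_ne (hz.1 h0)
    filter_upwards [nhdsWithin_le_nhds h3, self_mem_nhdsWithin] with t ht htI
    exact hv t htI ht
  · intro s hs h0
    rw [hv s hs (hz.1 h0), LinearIsometryEquiv.norm_map, LinearIsometryEquiv.norm_map]
    exact orbit_energy hω hE hM (hz.1 h0)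
  · intro s _ h0
    have h0' : hyperbolicMotion a b (X s) = 0 := by simpa using h0
    filter_upwards [self_mem_nhdsWithin] with σ hσ
    have hσ' : (0 : ℝ) < σ := hσ
    -- Times symmetric about the collision correspond to symmetric values of x; oddness of w then
    -- makes w² even.
    have hr : X (s - σ) = X s - (X (s + σ) - X s) := by
      apply (strictMono_keplerTime hω hab).injective
      have h1 := keplerTime_reflect (ω := ω) h0' (X (s + σ) - X s)
      rw [add_sub_cancel, hSX, hSX] at h1
      rw [hSX]; linarith
    constructor
    · rw [hz]
      intro h1
      have h2 := hyperbolicMotion_zero_unique hab h0' h1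
      have h3 := hSX (s + σ)
      rw [← h2, hSX] at h3
      linarith
    · rw [hr, ← neg_sq (hyperbolicMotion a b (X s - _)), ← hyperbolicMotion_reflect h0',
        add_sub_cancel]

end Orbit

/-! ### Uniqueness for the initial value problem, through collisions -/

section Uniqueness

variable {M E E' T : ℝ} {p₀ p₁ p₁' : Plane} {z z' : ℝ → Plane}

theorem IsKeplerArc.hasDerivWithinAt_position (h : IsKeplerArc M E p₀ p₁ T z) {s : ℝ}
    (hs : s ∈ Icc 0 T) (h0 : z s ≠ 0) : HasDerivWithinAt z (velocity T z s) (Icc 0 T) s :=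
  (h.differentiable s hs h0).hasDerivWithinAt

/-- The vector field of the Kepler problem on the phase space. -/
noncomputable def keplerField (M : ℝ) (y : Plane × Plane) : Plane × Plane :=
  (y.2, -(M / ‖y.1‖ ^ 3) • y.1)

theorem contDiffAt_keplerField (M : ℝ) {y : Plane × Plane} (hy : y.1 ≠ 0) :
    ContDiffAt ℝ 1 (keplerField M) y := by
  have h1 : ContDiffAt ℝ 1 (fun y : Plane × Plane => y.1) y := by fun_prop
  have h2 : ContDiffAt ℝ 1 (fun y : Plane × Plane => y.2) y := by fun_prop
  exact h2.prodMk (((contDiffAt_const.div ((h1.norm ℝ hy).pow 3)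
    (pow_ne_zero _ (norm_ne_zero_iff.2 hy))).neg).smul h1)

theorem IsKeplerArc.hasDerivWithinAt_phase (h : IsKeplerArc M E p₀ p₁ T z) {s : ℝ}
    (hs : s ∈ Icc 0 T) (h0 : z s ≠ 0) :
    HasDerivWithinAt (fun s => (z s, velocity T z s)) (keplerField M (z s, velocity T z s))
      (Icc 0 T) s :=
  (h.hasDerivWithinAt_position hs h0).prodMk (h.newton s hs h0)

/-- Away from the centre the Kepler field is locally Lipschitz, so the uniqueness theorem for ODEs
applies to the right of `s`. -/
theorem IsKeplerArc.eventually_eqOn_of_ne_zero (h : IsKeplerArc M E p₀ p₁ T z)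
    (h' : IsKeplerArc M E' p₀ p₁' T z') {s : ℝ} (hs : s ∈ Ico 0 T) (h0 : z s ≠ 0)
    (hz : z s = z' s) (hv : velocity T z s = velocity T z' s) :
    ∃ t ∈ Ioc s T, EqOn z z' (Icc s t) := by
  have hsT : s ∈ Icc 0 T := Ico_subset_Icc_self hs
  have h0' : z' s ≠ 0 := hz ▸ h0
  obtain ⟨K, U, hU, hK⟩ := (contDiffAt_keplerField M (y := (z s, velocity T z s))
    h0).exists_lipschitzOnWith
  have c := (h.hasDerivWithinAt_phase hsT h0).continuousWithinAt
  have c' := (h'.hasDerivWithinAt_phase hsT h0').continuousWithinAt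
  have e1 := c.eventually hU
  have e2 := c'.eventually
    (show ∀ᶠ y in 𝓝 (z' s, velocity T z' s), y ∈ U by rw [← hz, ← hv]; exact hU)
  have e3 := (h.cont s hsT).eventually_ne h0
  have e4 := (h'.cont s hsT).eventually_ne h0'
  have e5 := ((e1.and e2).and (e3.and e4))
  have hsub : 𝓝[>] s ≤ 𝓝[Icc 0 T] s := by
    rw [nhdsWithin_le_iff]
    exact mem_of_superset (Ioo_mem_nhdsGT hs.2) fun x hx => ⟨hs.1.trans hx.1.le, hx.2.le⟩
  have e6 := hsub e5
  obtain ⟨u, hu, hu'⟩ := (mem_nhdsGT_iff_exists_Ioo_subset' hs.2).1 e6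
  have hu0 : s < u := hu
  obtain ⟨t, ht1, ht2⟩ := exists_between (lt_min hu0 hs.2)
  have htT : t < T := ht2.trans_le (min_le_right _ _)
  have htu : t < u := ht2.trans_le (min_le_left _ _)
  refine ⟨t, ⟨ht1, htT.le⟩, ?_⟩
  have good : ∀ x ∈ Icc s t, ((z x, velocity T z x) ∈ U ∧ (z' x, velocity T z' x) ∈ U) ∧
      z x ≠ 0 ∧ z' x ≠ 0 := by
    intro x hx
    rcases eq_or_lt_of_le hx.1 with rfl | hx1
    · exact ⟨⟨mem_of_mem_nhds hU, by rw [← hz, ← hv]; exact mem_of_mem_nhds hU⟩, h0, h0'⟩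
    · exact hu' ⟨hx1, hx.2.trans_lt htu⟩
  have hIcc : ∀ x ∈ Icc s t, x ∈ Icc 0 T := fun x hx => ⟨hs.1.trans hx.1, hx.2.trans htT.le⟩
  have hIci : ∀ x ∈ Ico s t, Icc 0 T ∈ 𝓝[≥] x := fun x hx =>
    mem_of_superset (Icc_mem_nhdsGE (hx.2.trans htT)) fun y hy =>
      ⟨(hs.1.trans hx.1).trans hy.1, hy.2⟩
  have key := ODE_solution_unique_of_mem_Icc_right (v := fun _ => keplerField M)
    (s := fun _ => U) (K := K) (f := fun s => (z s, velocity T z s))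
    (g := fun s => (z' s, velocity T z' s)) (a := s) (b := t) (fun _ _ => hK)
    (fun x hx => (h.hasDerivWithinAt_phase (hIcc x hx) (good x hx).2.1).continuousWithinAt.mono
      hIcc)
    (fun x hx => (h.hasDerivWithinAt_phase (hIcc x (Ico_subset_Icc_self hx))
      (good x (Ico_subset_Icc_self hx)).2.1).mono_of_mem_nhdsWithin (hIci x hx))
    (fun x hx => (good x (Ico_subset_Icc_self hx)).1.1)
    (fun x hx => (h'.hasDerivWithinAt_phase (hIcc x hx) (good x hx).2.2).continuousWithinAt.mono
      hIcc)
    (fun x hx => (h'.hasDerivWithinAt_phase (hIcc x (Ico_subset_Icc_self hx))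
      (good x (Ico_subset_Icc_self hx)).2.2).mono_of_mem_nhdsWithin (hIci x hx))
    (fun x hx => (good x (Ico_subset_Icc_self hx)).1.2) (by simp only [hz, hv])
  exact fun x hx => congrArg Prod.fst (key hx)

/-- Two curves that agree before a common collision agree shortly after it. -/
theorem IsKeplerArc.eventually_eqOn_of_eq_zero (h : IsKeplerArc M E p₀ p₁ T z)
    (h' : IsKeplerArc M E' p₀ p₁' T z') {s : ℝ} (hs : s ∈ Ioo 0 T) (h0 : z s = 0)
    (hz : EqOn z z' (Icc 0 s)) : ∃ t ∈ Ioc s T, EqOn z z' (Icc s t) := by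
  have hsT := Ioo_subset_Icc_self hs
  have hzs := hz ⟨hs.1.le, le_rfl⟩
  have e := (h.bounce s hsT h0).and (h'.bounce s hsT (hzs ▸ h0))
  obtain ⟨u, hu, hu'⟩ := (mem_nhdsGT_iff_exists_Ioo_subset' (show (0 : ℝ) < 1 by norm_num)).1 e
  have hu0 : 0 < u := hu
  -- With δ < s the reflected times s - σ remain in [0, s], where the curves already agree.
  obtain ⟨δ, hδ0, hδ⟩ := exists_between (lt_min hu0 (lt_min hs.1 (sub_pos.2 hs.2)))
  simp only [lt_min_iff] at hδ
  refine ⟨s + δ, ⟨by linarith, by linarith⟩, fun x hx => ?_⟩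
  rcases eq_or_lt_of_le hx.1 with rfl | hx1
  · exact hzs
  · have hm := hu' (show x - s ∈ Ioo 0 u from ⟨by linarith, by linarith [hx.2]⟩)
    have e1 := hm.1.2
    have e2 := hm.2.2
    rw [add_sub_cancel] at e1 e2
    rw [e1, e2]
    exact hz ⟨by linarith [hx.2], by linarith⟩

/-- The velocity is already determined by the left derivative, that is, by the past on [0, s]. -/
theorem IsKeplerArc.velocity_eq_of_eqOn (h : IsKeplerArc M E p₀ p₁ T z)
    (h' : IsKeplerArc M E' p₀ p₁' T z') {s : ℝ} (hs : s ∈ Ioc 0 T) (h0 : z s ≠ 0)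
    (hz : EqOn z z' (Icc 0 s)) : velocity T z s = velocity T z' s := by
  have hsT := Ioc_subset_Icc_self hs
  have hss : s ∈ Icc 0 s := ⟨hs.1.le, le_rfl⟩
  have hsub : Icc 0 s ⊆ Icc 0 T := Icc_subset_Icc_right hs.2
  have d := (h.hasDerivWithinAt_position hsT h0).mono hsub
  have d' := (h'.hasDerivWithinAt_position hsT (hz hss ▸ h0)).mono hsub
  exact (uniqueDiffOn_Icc hs.1 s hss).eq_deriv _ (d) (d'.congr hz (hz hss))

/-- Kepler arcs, possibly with collisions, are determined by their initial position and velocity. -/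
theorem IsKeplerArc.eqOn_of_velocity_eq (h : IsKeplerArc M E p₀ p₁ T z)
    (h' : IsKeplerArc M E' p₀ p₁' T z') (hp : p₀ ≠ 0)
    (hv : velocity T z 0 = velocity T z' 0) : EqOn z z' (Icc 0 T) := by
  have hcl : IsClosed (Icc 0 T ∩ {t | z t = z' t}) := by
    have := (h.cont.prodMk h'.cont).preimage_isClosed_of_isClosed isClosed_Icc isClosed_diagonal
    exact this
  have hS : Icc 0 T ⊆ {s | EqOn z z' (Icc 0 s)} := by
    refine IsClosed.Icc_subset_of_forall_exists_gt ?_ ?_ ?_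
    · refine isClosed_of_closure_subset fun s hs => ?_
      have h1 : s ∈ Icc 0 T ∩ {t | z t = z' t} := by
        refine closure_minimal (fun t ht => ?_) hcl hs
        exact ⟨ht.2, ht.1 ⟨ht.2.1, le_rfl⟩⟩
      refine ⟨fun t ht => ?_, h1.1⟩
      rcases eq_or_lt_of_le ht.2 with rfl | hts
      · exact h1.2
      · obtain ⟨r, hr1, hr2⟩ := mem_closure_iff.1 hs (Ioi t) isOpen_Ioi hts
        exact hr2.1 ⟨ht.1, le_of_lt hr1⟩
    · intro t ht
      obtain rfl : t = 0 := le_antisymm ht.2 ht.1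
      rw [h.start, h'.start]
    · rintro s ⟨hs, hsT⟩ y hy
      have hs' : EqOn z z' (Icc 0 s) := hs
      have hext : ∃ t ∈ Ioc s T, EqOn z z' (Icc s t) := by
        have hzs := hs' ⟨hsT.1, le_rfl⟩
        rcases eq_or_lt_of_le hsT.1 with rfl | hs0
        · exact h.eventually_eqOn_of_ne_zero h' hsT (by rwa [h.start]) hzs hv
        · by_cases h0 : z s = 0
          · exact h.eventually_eqOn_of_eq_zero h' ⟨hs0, hsT.2⟩ h0 hs'
          · exact h.eventually_eqOn_of_ne_zero h' hsT h0 hzs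
              (h.velocity_eq_of_eqOn h' ⟨hs0, hsT.2.le⟩ h0 hs')
      obtain ⟨t, ht, hteq⟩ := hext
      refine ⟨min t y, fun x hx => ?_, lt_min ht.1 hy, min_le_right _ _⟩
      rcases le_total x s with hxs | hxs
      · exact hs' ⟨hx.1, hxs⟩
      · exact hteq ⟨hxs, hx.2.trans (min_le_left _ _)⟩
  exact hS ⟨h.pos.le, le_rfl⟩

end Uniqueness

/-! ### Homotopy classes through the square root covering -/

section Topology

/-- The continuous square root of the segment from `1` to `u ^ 2`, where `0 < Re u`. -/
theorem exists_sqrt_segment {u : ℂ} (hu : 0 < u.re) :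
    ∃ v : unitInterval → ℂ, Continuous v ∧ v 0 = 1 ∧ v 1 = u ∧ (∀ t, 0 < (v t).re) ∧
      ∀ t : unitInterval, v t ^ 2 = 1 + (t : ℝ) * (u ^ 2 - 1) := by
  have hu0 : u ≠ 0 := by rintro rfl; simp at hu
  have hslit : u ^ 2 ∈ Complex.slitPlane := by
    rw [Complex.mem_slitPlane_iff]
    by_contra! h
    have h2 : (u ^ 2).im = 2 * u.re * u.im := by rw [sq, Complex.mul_im]; ring
    have h1 : (u ^ 2).re = u.re ^ 2 - u.im ^ 2 := by rw [sq, Complex.mul_re]; ring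
    have h3 : u.im = 0 := by
      have := h.2; rw [h2] at this; simpa [hu.ne'] using this
    have := h.1
    rw [h1, h3] at this
    nlinarith
  have hseg : ∀ t : unitInterval, 1 + ((t : ℝ) : ℂ) * (u ^ 2 - 1) ∈ Complex.slitPlane := by
    intro t
    have h := Complex.starConvex_one_slitPlane hslit (a := 1 - t) (b := t)
      (by linarith [t.2.2]) t.2.1 (by ring)
    convert! h using 1
    simp only [Complex.real_smul]; push_cast; ring
  have hsq : ∀ x : ℂ, x ≠ 0 → Complex.exp (Complex.log x / 2) ^ 2 = x := fun x hx => by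
    rw [← Complex.exp_nat_mul, Nat.cast_ofNat, mul_div_cancel₀ _ two_ne_zero, Complex.exp_log hx]
  have hre : ∀ x ∈ Complex.slitPlane, 0 < (Complex.exp (Complex.log x / 2)).re := fun x hx => by
    rw [Complex.exp_re]
    refine mul_pos (Real.exp_pos _) (Real.cos_pos_of_mem_Ioo ?_)
    have h1 := Complex.neg_pi_lt_arg x
    have h2 := lt_of_le_of_ne (Complex.arg_le_pi x) (Complex.slitPlane_arg_ne_pi hx)
    have h3 : (Complex.log x / 2).im = x.arg / 2 := by
      rw [← Complex.log_im, ← Complex.ofReal_ofNat, Complex.div_ofReal_im]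
    rw [h3]
    constructor <;> linarith
  refine ⟨fun t => Complex.exp (Complex.log (1 + (t : ℝ) * (u ^ 2 - 1)) / 2), ?_, by simp, ?_,
    fun t => hre _ (hseg t), fun t => hsq _ (Complex.slitPlane_ne_zero (hseg t))⟩
  · exact Complex.continuous_exp.comp ((Continuous.clog (by fun_prop) hseg).div_const 2)
  · have h1 := hsq (u ^ 2) (pow_ne_zero _ hu0)
    have h2 := hre _ hslit
    rcases sq_eq_sq_iff_eq_or_eq_neg.1 h1 with h | h
    · simpa using h
    · rw [h, Complex.neg_re] at h2; linarith

/-- The homeomorphism between the punctured complex line and the punctured plane. -/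
noncomputable def complexPunctured : {w : ℂ // w ≠ 0} ≃ₜ PuncturedPlane :=
  complexPlane.toHomeomorph.subtype fun w => by simp

theorem complexPunctured_apply (w : {w : ℂ // w ≠ 0}) :
    (complexPunctured w : Plane) = complexPlane w := rfl

variable {T : ℝ} {z : ℝ → Plane} {w : unitInterval → ℂ}

theorem lineMap_complexPlane_sq {w₀ w₁ v : ℂ} {t : ℝ} (h0 : w₀ ≠ 0)
    (hv : v ^ 2 = 1 + t * ((w₁ / w₀) ^ 2 - 1)) :
    AffineMap.lineMap (complexPlane (w₀ ^ 2)) (complexPlane (w₁ ^ 2)) t =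
      complexPlane ((w₀ * v) ^ 2) := by
  rw [AffineMap.lineMap_apply_module', ← map_sub, ← map_smul, ← map_add, mul_pow, hv,
    Complex.real_smul]
  congr 1
  field_simp
  ring

/-- A curve whose square root stays in a half-plane is homotopic to the segment. -/
theorem not_topologicallyNontrivial_of_re_pos (hw : Continuous w)
    (hz : ∀ t : unitInterval, z (t * T) = complexPlane (w t ^ 2)) (h0 : w 0 ≠ 0)
    (hre : ∀ t, 0 < (w t / w 0).re) :
    ¬ TopologicallyNontrivial (complexPlane (w 0 ^ 2)) (complexPlane (w 1 ^ 2)) T z := by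
  rw [TopologicallyNontrivial, not_not]
  obtain ⟨v, hv, hv0, hv1, hvre, hvsq⟩ := exists_sqrt_segment (hre 1)
  let H : Set ℂ := {u | 0 < u.re}
  -- In the half-plane the two square roots are homotopic; the homotopy is pushed forward by u ↦
  -- (w₀u)².
  have : ContractibleSpace H := (convex_halfSpace_re_gt 0).contractibleSpace ⟨1, by simp⟩
  have hH : ∀ u : H, (w 0 * u) ^ 2 ≠ 0 := fun u => pow_ne_zero _ <| mul_ne_zero h0 fun h => by
    have := u.2; simp [H, h] at this
  let f : C(H, PuncturedPlane) := ⟨fun u => complexPunctured ⟨(w 0 * u) ^ 2, hH u⟩, by fun_prop⟩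
  let x : H := ⟨1, by simp [H]⟩
  let y : H := ⟨w 1 / w 0, hre 1⟩
  let α : Path x y :=
    { toFun := fun t => ⟨w t / w 0, hre t⟩
      continuous_toFun := by fun_prop
      source' := Subtype.ext (by simp [x, h0])
      target' := rfl }
  let β : Path x y :=
    { toFun := fun t => ⟨v t, hvre t⟩
      continuous_toFun := by fun_prop
      source' := Subtype.ext (by simp [x, hv0])
      target' := Subtype.ext (by simp [y, hv1]) }
  refine ⟨f x, f y, α.map f.continuous, β.map f.continuous, fun t => ?_, fun t => ?_,
    (SimplyConnectedSpace.paths_homotopic α β).map f⟩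
  · rw [hz]
    change complexPlane ((w 0 * (w t / w 0)) ^ 2) = _
    rw [mul_div_cancel₀ _ h0]
  · rw [lineMap_complexPlane_sq h0 (hvsq t)]
    rfl

/-- A curve whose square root turns by more than a right angle is not homotopic to the segment. -/
theorem topologicallyNontrivial_of_re_neg (hw : Continuous w)
    (hz : ∀ t : unitInterval, z (t * T) = complexPlane (w t ^ 2)) (h0 : w 0 ≠ 0)
    (hre : (w 1 / w 0).re < 0) :
    TopologicallyNontrivial (complexPlane (w 0 ^ 2)) (complexPlane (w 1 ^ 2)) T z := by
  rintro ⟨x, y, α, β, hα, hβ, hαβ⟩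
  obtain ⟨v, hv, hv0, hv1, hvre, hvsq⟩ := exists_sqrt_segment (u := -(w 1 / w 0))
    (by simpa using hre)
  have hwne : ∀ t, w t ≠ 0 := fun t h => (α t).2 (by rw [hα, hz, h]; simp)
  have hvne : ∀ t, w 0 * v t ≠ 0 := fun t => mul_ne_zero h0 fun h => by
    have := hvre t; simp [h] at this
  have cov := (isCoveringMap_npow (𝕜 := ℂ) 2 (by norm_num)).homeomorph_comp complexPunctured
  let Γ : C(unitInterval, {w : ℂ // w ≠ 0}) := ⟨fun t => ⟨w t, hwne t⟩, by fun_prop⟩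
  let Δ : C(unitInterval, {w : ℂ // w ≠ 0}) := ⟨fun t => ⟨w 0 * v t, hvne t⟩, by fun_prop⟩
  have hΓ : ∀ t, α t = complexPunctured ⟨(Γ t : ℂ) ^ 2, pow_ne_zero _ (Γ t).2⟩ := fun t =>
    Subtype.ext (by rw [hα, hz, complexPunctured_apply]; rfl)
  have hΔ : ∀ t, β t = complexPunctured ⟨(Δ t : ℂ) ^ 2, pow_ne_zero _ (Δ t).2⟩ := fun t =>
    Subtype.ext (by
      rw [hβ, lineMap_complexPlane_sq h0 ((hvsq t).trans (by rw [neg_sq])),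
        complexPunctured_apply]; rfl)
  have hΔ0 : Δ 0 = Γ 0 := Subtype.ext (by simp [Γ, Δ, hv0])
  -- Homotopic paths have lifts with the same end, but the curve lifts to a path ending at w₁ and
  -- the segment to one ending at -w₁.
  have key := cov.liftPath_apply_one_eq_of_homotopicRel hαβ (Γ 0) (hΓ 0)
    ((hΔ 0).trans (by rw [hΔ0]; rfl))
  rw [← (cov.eq_liftPath_iff' _ (Γ := Γ)).2 ⟨funext fun t => (hΓ t).symm, rfl⟩,
    ← (cov.eq_liftPath_iff' _ (Γ := Δ)).2 ⟨funext fun t => (hΔ t).symm, hΔ0⟩] at key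
  have h1 : w 1 = -w 1 := by
    have := congrArg Subtype.val key
    simp only [Γ, Δ, ContinuousMap.coe_mk, hv1] at this
    rw [mul_neg, mul_div_cancel₀ _ h0] at this
    exact this
  exact hwne 1 (self_eq_neg.1 h1)

end Topology

/-! ### The two-point problem for hyperbolic motions -/

section BoundaryValue

variable {a b w : ℂ} {θ ε : ℝ}

theorem re_div_eq_dot (w a : ℂ) :
    (w / a).re = (a.re * w.re + a.im * w.im) / Complex.normSq a := by
  rw [Complex.div_re]; ring

theorem norm_complexPlane_sq (w : ℂ) : ‖complexPlane (w ^ 2)‖ = Complex.normSq w := by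
  rw [LinearIsometryEquiv.norm_map, norm_pow, Complex.normSq_eq_norm_sq]

theorem exists_complexPlane_sq (p : Plane) : ∃ w : ℂ, p = complexPlane (w ^ 2) := by
  obtain ⟨w, hw⟩ := IsAlgClosed.exists_pow_nat_eq (complexPlane.symm p) two_pos
  exact ⟨w, by rw [hw]; simp⟩

/-- This is the half-angle formula: ⟨a², w²⟩ = 2⟨a, w⟩² - |a|²|w|². -/
theorem halfAngleTerm_complexPlane_sq (a w : ℂ) :
    halfAngleTerm (complexPlane (a ^ 2), complexPlane (w ^ 2)) =
      |a.re * w.re + a.im * w.im| := by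
  have h : (‖complexPlane (a ^ 2)‖ * ‖complexPlane (w ^ 2)‖ +
      inner ℝ (complexPlane (a ^ 2)) (complexPlane (w ^ 2))) / 2 =
        (a.re * w.re + a.im * w.im) ^ 2 := by
    rw [norm_complexPlane_sq, norm_complexPlane_sq, LinearIsometryEquiv.inner_map_map,
      Complex.inner]
    simp only [Complex.normSq_apply, Complex.mul_re, Complex.conj_re, Complex.conj_im, sq,
      Complex.mul_im]
    ring
  rw [halfAngleTerm, h, Real.sqrt_sq_eq_abs]

theorem NonAntipodal.dot_ne_zero
    (h : NonAntipodal (complexPlane (a ^ 2)) (complexPlane (w ^ 2))) :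
    a.re * w.re + a.im * w.im ≠ 0 := by
  rw [← abs_pos, ← halfAngleTerm_complexPlane_sq]
  exact halfAngleTerm_pos (x := (_, _)) h

theorem ne_zero_of_dot_ne_zero (h : a.re * w.re + a.im * w.im ≠ 0) : a ≠ 0 := by
  rintro rfl; simp at h

/-- The hyperbolic angle of a hyperbolic motion between vectors at an obtuse angle. -/
theorem mul_cosh_eq_arcCosh (hε : 0 < ε) (hb : Complex.normSq b - Complex.normSq a = ε)
    (hm : a.re * (hyperbolicMotion a b θ).re + a.im * (hyperbolicMotion a b θ).im < 0) :
    ε * Real.cosh θ = arcCosh (ε, complexPlane (a ^ 2),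
      complexPlane (hyperbolicMotion a b θ ^ 2)) := by
  have hd := halfAngleTerm_complexPlane_sq a (hyperbolicMotion a b θ)
  rw [abs_of_neg hm] at hd
  have hC := Real.cosh_pos θ
  rw [arcCosh, arcDiscr, norm_complexPlane_sq, norm_complexPlane_sq]
  dsimp only
  rw [hd]
  set m := a.re * (hyperbolicMotion a b θ).re + a.im * (hyperbolicMotion a b θ).im with hmdef
  have key : (ε * Real.cosh θ + m) ^ 2 = (-m) ^ 2 +
      ε * (Complex.normSq a + Complex.normSq (hyperbolicMotion a b θ)) + ε ^ 2 := by
    rw [hmdef, ← hb]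
    simp only [Complex.normSq_apply, hyperbolicMotion_re, hyperbolicMotion_im]
    have hs := Real.cosh_sq θ
    generalize Real.cosh θ = c at *
    generalize Real.sinh θ = s at *
    linear_combination ((b.re * b.re + b.im * b.im - (a.re * a.re + a.im * a.im)) *
      (b.re * b.re + b.im * b.im)) * hs
  -- This excludes the other root: if negative, the left side would have absolute value below |m|,
  -- while its square is at least m².
  have hpos : 0 ≤ ε * Real.cosh θ + m := by
    by_contra! hneg
    have h1 : 0 ≤ ε * (Complex.normSq a + Complex.normSq (hyperbolicMotion a b θ)) :=
      mul_nonneg hε.le (add_nonneg (Complex.normSq_nonneg _) (Complex.normSq_nonneg _))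
    have h2 : 0 < ε * Real.cosh θ := by positivity
    nlinarith
  rw [← key, Real.sqrt_sq hpos]
  ring

/-- Existence of a hyperbolic motion between vectors at an obtuse angle. -/
theorem exists_hyperbolicMotion_eq (hε : 0 < ε) (hm : a.re * w.re + a.im * w.im < 0) :
    ∃ (b : ℂ) (θ : ℝ), 0 < θ ∧ Complex.normSq b - Complex.normSq a = ε ∧
      hyperbolicMotion a b θ = w := by
  set m := a.re * w.re + a.im * w.im with hmdef
  set D := m ^ 2 + ε * (Complex.normSq a + Complex.normSq w) + ε ^ 2 with hD
  have hr : 0 ≤ ε * (Complex.normSq a + Complex.normSq w) :=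
    mul_nonneg hε.le (add_nonneg (Complex.normSq_nonneg _) (Complex.normSq_nonneg _))
  have hDsq : √D ^ 2 = D := Real.sq_sqrt (by positivity)
  have hDε : ε ≤ √D := Real.le_sqrt_of_sq_le (by rw [hD]; nlinarith)
  -- `C` is the value of cosh θ; the velocity is then forced by w = aC + b sinh θ, and the quadratic
  -- equation for `C` is exactly the energy condition on b.
  set C := (-m + √D) / ε with hC
  have hC1 : 1 < C := by rw [hC, one_lt_div hε]; linarith
  have hεC : ε * C = -m + √D := by rw [hC]; field_simp
  have hquad : ε * C ^ 2 + 2 * m * C = Complex.normSq a + Complex.normSq w + ε := by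
    have : (ε * C + m) ^ 2 = D := by rw [hεC]; linear_combination hDsq
    rw [hD] at this
    have h2 : ε * (ε * C ^ 2 + 2 * m * C) = ε * (Complex.normSq a + Complex.normSq w + ε) := by
      linear_combination this
    exact mul_left_cancel₀ hε.ne' h2
  have hθ := Real.arcosh_pos hC1
  have hS : 0 < Real.sinh (Real.arcosh C) := Real.sinh_pos_iff.2 hθ
  have hcosh := Real.cosh_arcosh hC1.le
  have hsq := Real.cosh_sq (Real.arcosh C)
  rw [hcosh] at hsq
  refine ⟨(w - a * C) / (Real.sinh (Real.arcosh C) : ℂ), Real.arcosh C, hθ, ?_, ?_⟩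
  · rw [Complex.normSq_div, Complex.normSq_ofReal, sub_eq_iff_eq_add, div_eq_iff (by positivity)]
    generalize Real.sinh (Real.arcosh C) = S at *
    rw [hmdef] at hquad
    simp only [Complex.normSq_apply, Complex.sub_re, Complex.sub_im, Complex.re_mul_ofReal,
      Complex.im_mul_ofReal] at hquad ⊢
    linear_combination -hquad + (ε + a.re * a.re + a.im * a.im) * hsq
  · have : (Real.sinh (Real.arcosh C) : ℂ) ≠ 0 := Complex.ofReal_ne_zero.2 hS.ne'
    rw [hyperbolicMotion, hcosh, div_mul_cancel₀ _ this]
    ring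

/-- By linearity sinh θ · w(x) = sinh(θ - x) · a + sinh x · w(θ), a combination with nonnegative
coefficients of two vectors that have positive inner product with a. -/
theorem re_hyperbolicMotion_div_pos (ha : a ≠ 0) {x : ℝ} (hx : x ∈ Icc 0 θ) (hθ : 0 < θ)
    (hm : 0 < a.re * (hyperbolicMotion a b θ).re + a.im * (hyperbolicMotion a b θ).im) :
    0 < (hyperbolicMotion a b x / a).re := by
  have hn := Complex.normSq_pos.2 ha
  rw [re_div_eq_dot]
  refine div_pos ?_ hn
  have hS : 0 < Real.sinh θ := Real.sinh_pos_iff.2 hθ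
  refine pos_of_mul_pos_right (a := Real.sinh θ) ?_ hS.le
  have hid : Real.sinh θ * (a.re * (hyperbolicMotion a b x).re +
      a.im * (hyperbolicMotion a b x).im) = Complex.normSq a * Real.sinh (θ - x) +
      (a.re * (hyperbolicMotion a b θ).re + a.im * (hyperbolicMotion a b θ).im) *
        Real.sinh x := by
    simp only [Complex.normSq_apply, hyperbolicMotion_re, hyperbolicMotion_im, Real.sinh_sub]
    ring
  rw [hid]
  rcases eq_or_lt_of_le hx.1 with rfl | hx0
  · simpa using mul_pos hn hS
  · have h1 : 0 ≤ Real.sinh (θ - x) := Real.sinh_nonneg_iff.2 (by linarith [hx.2])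
    have h2 : 0 < Real.sinh x := Real.sinh_pos_iff.2 hx0
    positivity

end BoundaryValue

/-! ### Existence and uniqueness of the non-trivial arc -/

section Classification

variable {M E T : ℝ} {p₀ p₁ : Plane} {z : ℝ → Plane} {a b : ℂ} {ω : ℝ} {X : ℝ → ℝ}

/-- The data of a Kepler orbit in regularized coordinates: the hyperbolic motion with initial
position `a` and initial velocity `b`, its eccentric anomaly `X`, and the agreement with the curve
`z` on `[0, T]`. -/
structure IsRegularizedBy (z : ℝ → Plane) (T ω ε : ℝ) (a b : ℂ) (X : ℝ → ℝ) : Prop where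
  energy : Complex.normSq b - Complex.normSq a = ε
  continuous : Continuous X
  time : ∀ s, keplerTime a b ω (X s) = s
  eqOn : EqOn z (fun s => complexPlane (hyperbolicMotion a b (X s) ^ 2)) (Icc 0 T)

/-- Every Kepler arc of positive energy is, in regularized coordinates, a hyperbolic motion. -/
theorem IsKeplerArc.exists_isRegularizedBy (h : IsKeplerArc M E p₀ p₁ T z) (hM : 0 < M)
    (hω : 0 < ω) (hE : E = 2 * ω ^ 2) (hp : p₀ = complexPlane (a ^ 2)) (ha : a ≠ 0) :
    ∃ b X, IsRegularizedBy z T ω (M / E) a b X := by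
  have hE0 : 0 < E := by rw [hE]; positivity
  have hp0 : p₀ ≠ 0 := by rw [hp]; simpa using ha
  have h0 : (0 : ℝ) ∈ Icc 0 T := ⟨le_rfl, h.pos.le⟩
  -- Obtained by solving z'(0) = 2ωb/ā for b.
  set b : ℂ := complexPlane.symm (velocity T z 0) * conj a / (2 * ω) with hb
  have hωc : (ω : ℂ) ≠ 0 := Complex.ofReal_ne_zero.2 hω.ne'
  have hen : Complex.normSq b - Complex.normSq a = M / E := by
    have h1 := h.energy 0 h0 (by rwa [h.start])
    rw [h.start, hp, norm_complexPlane_sq] at h1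
    have hn := Complex.normSq_pos.2 ha
    have h2 : ‖velocity T z 0‖ ^ 2 = 2 * (E + M / Complex.normSq a) := by linarith
    have h3 : Complex.normSq b = ‖velocity T z 0‖ ^ 2 * Complex.normSq a / (4 * ω ^ 2) := by
      rw [hb, Complex.normSq_div, map_mul, map_mul, Complex.normSq_conj, Complex.normSq_ofReal,
        Complex.normSq_eq_norm_sq (complexPlane.symm _), LinearIsometryEquiv.norm_map]
      rw [show Complex.normSq 2 = 4 by norm_num [Complex.normSq_apply]]
      ring
    rw [h3, h2, hE]
    field_simp
    ring
  have hMω : M = 2 * ω ^ 2 * (Complex.normSq b - Complex.normSq a) := by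
    rw [hen, ← hE]; field_simp
  have hab : Complex.normSq a < Complex.normSq b := by
    have : 0 < M / E := by positivity
    linarith
  obtain ⟨X, hX, hSX, hXS⟩ := exists_eccentricAnomaly hω hab
  have hX0 : X 0 = 0 := by simpa using hXS 0
  refine ⟨b, X, hen, hX, hSX, ?_⟩
  have harc := orbit_isKeplerArc (X := X) hω h.pos hE hMω hM hX hSX
  have hst : complexPlane (hyperbolicMotion a b (X 0) ^ 2) = p₀ := by
    rw [hX0, hyperbolicMotion_zero, hp]
  rw [hst] at harc
  refine h.eqOn_of_velocity_eq harc hp0 ?_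
  have hne : hyperbolicMotion a b (X 0) ≠ 0 := by simpa [hX0] using ha
  have hd := complexPlane.toContinuousLinearEquiv.hasFDerivAt.comp_hasDerivAt 0
    (hasDerivAt_orbit hω hX hSX hne)
  have hv := hd.hasDerivWithinAt.derivWithin (uniqueDiffOn_Icc h.pos 0 h0)
  refine Eq.trans ?_ hv.symm
  rw [hX0, hyperbolicMotion_zero, hyperbolicMotion_zero, hb]
  have hca : conj a ≠ 0 := by simpa using ha
  have : 2 * (ω : ℂ) * (complexPlane.symm (velocity T z 0) * conj a / (2 * ω)) / conj a =
      complexPlane.symm (velocity T z 0) := by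
    field_simp
  rw [this]
  exact (complexPlane.apply_symm_apply _).symm

variable {ε : ℝ}

namespace IsRegularizedBy

theorem lt (h : IsRegularizedBy z T ω ε a b X) (hε : 0 < ε) :
    Complex.normSq a < Complex.normSq b := by linarith [h.energy]

theorem strictMono (h : IsRegularizedBy z T ω ε a b X) (hω : 0 < ω) (hε : 0 < ε) :
    StrictMono X := by
  intro s t hst
  rwa [← (strictMono_keplerTime hω (h.lt hε)).lt_iff_lt, h.time, h.time]

theorem map_zero (h : IsRegularizedBy z T ω ε a b X) (hω : 0 < ω) (hε : 0 < ε) : X 0 = 0 :=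
  (strictMono_keplerTime hω (h.lt hε)).injective (by rw [h.time, keplerTime_zero])

/-- An orbit from `p₀` to `p₁` is topologically non-trivial if and only if the square roots of its
end points form an obtuse angle. -/
theorem topologicallyNontrivial_iff (h : IsRegularizedBy z T ω ε a b X) (hω : 0 < ω) (hε : 0 < ε)
    (hT : 0 < T) (ha : a ≠ 0) (hp₀ : z 0 = p₀) (hp₁ : z T = p₁) (hN : NonAntipodal p₀ p₁) :
    TopologicallyNontrivial p₀ p₁ T z ↔ a.re * (hyperbolicMotion a b (X T)).re +
      a.im * (hyperbolicMotion a b (X T)).im < 0 := by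
  let w : unitInterval → ℂ := fun t => hyperbolicMotion a b (X (t * T))
  have hw : Continuous w := (continuous_hyperbolicMotion a b).comp (h.continuous.comp (by fun_prop))
  have hI : ∀ t : unitInterval, (t : ℝ) * T ∈ Icc 0 T := fun t =>
    ⟨mul_nonneg t.2.1 hT.le, mul_le_of_le_one_left hT.le t.2.2⟩
  have hz : ∀ t : unitInterval, z (t * T) = complexPlane (w t ^ 2) := fun t => h.eqOn (hI t)
  have hw0 : w 0 = a := by simp [w, h.map_zero hω hε]
  have hw1 : w 1 = hyperbolicMotion a b (X T) := by simp [w]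
  have e0 : p₀ = complexPlane (w 0 ^ 2) := by rw [← hz 0, ← hp₀]; simp
  have e1 : p₁ = complexPlane (w 1 ^ 2) := by rw [← hz 1, ← hp₁]; simp
  have hne : a.re * (w 1).re + a.im * (w 1).im ≠ 0 := by
    rw [e0, e1, hw0] at hN; exact hN.dot_ne_zero
  have hn := Complex.normSq_pos.2 ha
  rw [← hw1]
  constructor
  · intro hnt
    by_contra! hm
    have hm' := lt_of_le_of_ne hm hne.symm
    rw [e0, e1] at hnt
    refine not_topologicallyNontrivial_of_re_pos hw hz (by rwa [hw0]) (fun t => ?_) hnt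
    rw [hw0]
    have hmono := (h.strictMono hω hε).monotone
    refine re_hyperbolicMotion_div_pos (θ := X T) ha ⟨?_, hmono (hI t).2⟩ ?_ (hw1 ▸ hm')
    · rw [← h.map_zero hω hε]; exact hmono (hI t).1
    · rw [← h.map_zero hω hε]; exact h.strictMono hω hε hT
  · intro hm
    rw [e0, e1]
    refine topologicallyNontrivial_of_re_neg hw hz (by rwa [hw0]) ?_
    rw [hw0, re_div_eq_dot]
    exact div_neg_of_neg_of_pos hm hn

end IsRegularizedBy

/-- Existence of a topologically non-trivial Kepler arc. -/
theorem exists_nontrivial_keplerArc (hM : 0 < M) (hE : 0 < E) (hN : NonAntipodal p₀ p₁) :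
    ∃ T z, IsKeplerArc M E p₀ p₁ T z ∧ TopologicallyNontrivial p₀ p₁ T z := by
  obtain ⟨a, rfl⟩ := exists_complexPlane_sq p₀
  -- Of the two roots ±w of p₁, exactly one forms an obtuse angle with a.
  obtain ⟨w, hw, hm⟩ : ∃ w : ℂ, p₁ = complexPlane (w ^ 2) ∧ a.re * w.re + a.im * w.im < 0 := by
    obtain ⟨w, rfl⟩ := exists_complexPlane_sq p₁
    rcases lt_or_gt_of_ne hN.dot_ne_zero with h | h
    · exact ⟨w, rfl, h⟩
    · exact ⟨-w, by rw [neg_sq], by simp only [Complex.neg_re, Complex.neg_im]; linarith⟩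
  subst hw
  have ha := ne_zero_of_dot_ne_zero hN.dot_ne_zero
  have hε : 0 < M / E := by positivity
  obtain ⟨b, θ, hθ, hb, hwθ⟩ := exists_hyperbolicMotion_eq hε hm
  have hω : 0 < √(E / 2) := by positivity
  have hEω : E = 2 * √(E / 2) ^ 2 := by rw [Real.sq_sqrt (by positivity)]; ring
  have hab : Complex.normSq a < Complex.normSq b := by linarith
  obtain ⟨X, hX, hSX, hXS⟩ := exists_eccentricAnomaly hω hab
  have hT : 0 < keplerTime a b (√(E / 2)) θ := by
    have := strictMono_keplerTime hω hab hθ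
    rwa [keplerTime_zero] at this
  have hX0 : X 0 = 0 := by simpa using hXS 0
  have harc := orbit_isKeplerArc (M := M) hω hT hEω
    (by rw [hb, ← hEω]; field_simp) hM hX hSX
  rw [hX0, hyperbolicMotion_zero, hXS, hwθ] at harc
  refine ⟨_, _, harc, ?_⟩
  have hreg : IsRegularizedBy (fun s => complexPlane (hyperbolicMotion a b (X s) ^ 2))
    (keplerTime a b (√(E / 2)) θ) (√(E / 2)) (M / E) a b X := ⟨hb, hX, hSX, fun _ _ => rfl⟩
  refine (hreg.topologicallyNontrivial_iff hω hε hT ha harc.start harc.finish hN).2 ?_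
  rwa [hXS, hwθ]

/-- Uniqueness of the topologically non-trivial Kepler arc. -/
theorem nontrivial_keplerArc_unique (hM : 0 < M) (hE : 0 < E) (hN : NonAntipodal p₀ p₁)
    {T' : ℝ} {z' : ℝ → Plane} (h : IsKeplerArc M E p₀ p₁ T z)
    (ht : TopologicallyNontrivial p₀ p₁ T z) (h' : IsKeplerArc M E p₀ p₁ T' z')
    (ht' : TopologicallyNontrivial p₀ p₁ T' z') : T' = T ∧ EqOn z' z (Icc 0 T) := by
  obtain ⟨a, ha⟩ := exists_complexPlane_sq p₀
  have ha0 : a ≠ 0 := by rintro rfl; exact hN.left_ne_zero (by simp [ha])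
  have hε : 0 < M / E := by positivity
  have hω : 0 < √(E / 2) := by positivity
  have hEω : E = 2 * √(E / 2) ^ 2 := by rw [Real.sq_sqrt (by positivity)]; ring
  obtain ⟨b, X, hr⟩ := h.exists_isRegularizedBy hM hω hEω ha ha0
  obtain ⟨b', X', hr'⟩ := h'.exists_isRegularizedBy hM hω hEω ha ha0
  have hm := (hr.topologicallyNontrivial_iff hω hε h.pos ha0 h.start h.finish hN).1 ht
  have hm' := (hr'.topologicallyNontrivial_iff hω hε h'.pos ha0 h'.start h'.finish hN).1 ht'
  have e := hr.eqOn ⟨h.pos.le, le_rfl⟩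
  have e' := hr'.eqOn ⟨h'.pos.le, le_rfl⟩
  rw [h.finish] at e
  rw [h'.finish] at e'
  have hsq := complexPlane.injective (e.symm.trans e')
  -- Both end values are roots of p₁ at an obtuse angle with a, so they cannot be opposite.
  have hw : hyperbolicMotion a b (X T) = hyperbolicMotion a b' (X' T') := by
    rcases sq_eq_sq_iff_eq_or_eq_neg.1 hsq with hw | hw
    · exact hw
    · rw [hw, Complex.neg_re, Complex.neg_im] at hm
      linarith
  have hc := mul_cosh_eq_arcCosh hε hr.energy hm
  have hc' := mul_cosh_eq_arcCosh hε hr'.energy hm'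
  rw [hw, ← hc'] at hc
  have hpos : 0 < X T := hr.map_zero hω hε ▸ hr.strictMono hω hε h.pos
  have hpos' : 0 < X' T' := hr'.map_zero hω hε ▸ hr'.strictMono hω hε h'.pos
  have hθ : X T = X' T' :=
    Real.cosh_strictMonoOn.injOn hpos.le hpos'.le (mul_left_cancel₀ hε.ne' hc)
  have hbb : b = b' := by
    have hs : ((Real.sinh (X' T') : ℝ) : ℂ) ≠ 0 :=
      Complex.ofReal_ne_zero.2 (Real.sinh_pos_iff.2 hpos').ne'
    rw [hyperbolicMotion, hyperbolicMotion, hθ] at hw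
    exact mul_right_cancel₀ hs (add_left_cancel hw)
  subst hbb
  have hTT : T' = T := by rw [← hr.time T, ← hr'.time T', hθ]
  subst hTT
  refine ⟨rfl, fun s hs => ?_⟩
  have hXX : X' s = X s := (strictMono_keplerTime hω (hr.lt hε)).injective
    (by rw [hr.time, hr'.time])
  rw [hr.eqOn hs, hr'.eqOn hs]
  simp only [hXX]

end Classification

/-! ### The Jacobi length -/

section Length

variable {M E T : ℝ} {p₀ p₁ : Plane} {z : ℝ → Plane} {a b : ℂ} {ω ε : ℝ} {X : ℝ → ℝ}

theorem IsKeplerArc.jacobiIntegrand_eq (h : IsKeplerArc M E p₀ p₁ T z) {s : ℝ}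
    (hs : s ∈ Icc 0 T) (h0 : z s ≠ 0) (hM : 0 < M) (hE : 0 < E) :
    jacobiIntegrand M E T z s = √2 * (E + M / ‖z s‖) := by
  have hp : 0 < ‖z s‖ := norm_pos_iff.2 h0
  have h1 : ‖velocity T z s‖ ^ 2 = 2 * (E + M / ‖z s‖) := by linarith [h.energy s hs h0]
  have h2 : 0 ≤ E + M / ‖z s‖ := by positivity
  rw [jacobiIntegrand, ← Real.sqrt_sq (norm_nonneg (velocity T z s)), h1,
    Real.sqrt_mul (by norm_num), mul_assoc, Real.mul_self_sqrt h2]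

/-- The derivative of the inner product of position and velocity of a hyperbolic motion. -/
theorem hasDerivAt_dot_hyperbolicMotion (a b : ℂ) (x : ℝ) :
    HasDerivAt (fun x => (hyperbolicMotion a b x).re * (hyperbolicMotion b a x).re +
      (hyperbolicMotion a b x).im * (hyperbolicMotion b a x).im)
      (Complex.normSq (hyperbolicMotion a b x) + Complex.normSq (hyperbolicMotion b a x)) x := by
  have h1 := hasDerivAt_hyperbolicMotion a b x
  have h2 := hasDerivAt_hyperbolicMotion b a x
  have hre : ∀ {f : ℝ → ℂ} {f' : ℂ}, HasDerivAt f f' x →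
      HasDerivAt (fun x => (f x).re) f'.re x := fun h =>
    Complex.reCLM.hasFDerivAt.comp_hasDerivAt x h
  have him : ∀ {f : ℝ → ℂ} {f' : ℂ}, HasDerivAt f f' x →
      HasDerivAt (fun x => (f x).im) f'.im x := fun h =>
    Complex.imCLM.hasFDerivAt.comp_hasDerivAt x h
  refine (((hre h1).mul (hre h2)).add ((him h1).mul (him h2))).congr_deriv ?_
  simp only [Complex.normSq_apply]
  ring

/-- Since |w'|² - |w|² = ε, 2|w'|² = (|w|² + |w'|²) + ε is the derivative of ⟨w, w'⟩ + εx. -/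
theorem integral_normSq_hyperbolicMotion (hb : Complex.normSq b - Complex.normSq a = ε) (θ : ℝ) :
    ∫ x in (0 : ℝ)..θ, Complex.normSq (hyperbolicMotion b a x) =
      ((hyperbolicMotion a b θ).re * (hyperbolicMotion b a θ).re +
        (hyperbolicMotion a b θ).im * (hyperbolicMotion b a θ).im -
        (a.re * b.re + a.im * b.im) + ε * θ) / 2 := by
  have hd : ∀ x ∈ uIcc 0 θ, HasDerivAt (fun x =>
      ((hyperbolicMotion a b x).re * (hyperbolicMotion b a x).re +
        (hyperbolicMotion a b x).im * (hyperbolicMotion b a x).im + ε * x) / 2)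
      (Complex.normSq (hyperbolicMotion b a x)) x := fun x _ => by
    have h := ((hasDerivAt_dot_hyperbolicMotion a b x).add
      ((hasDerivAt_id x).const_mul ε)).div_const 2
    refine h.congr_deriv ?_
    have := normSq_hyperbolicMotion_sub a b x
    linarith
  have hc : Continuous fun x => Complex.normSq (hyperbolicMotion b a x) :=
    Complex.continuous_normSq.comp (continuous_hyperbolicMotion b a)
  rw [intervalIntegral.integral_eq_sub_of_hasDerivAt hd (hc.intervalIntegrable _ _)]
  simp only [hyperbolicMotion_zero]
  ring

theorem IsRegularizedBy.image_keplerTime (h : IsRegularizedBy z T ω ε a b X) (hω : 0 < ω)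
    (hε : 0 < ε) : keplerTime a b ω '' Icc 0 (X T) = Icc 0 T := by
  have hmono := strictMono_keplerTime hω (h.lt hε)
  ext s
  constructor
  · rintro ⟨x, hx, rfl⟩
    have h1 := hmono.monotone hx.1
    have h2 := hmono.monotone hx.2
    rw [keplerTime_zero] at h1
    rw [h.time] at h2
    exact ⟨h1, h2⟩
  · intro hs
    have hX := (h.strictMono hω hε).monotone
    exact ⟨X s, ⟨h.map_zero hω hε ▸ hX hs.1, hX hs.2⟩, h.time s⟩

/-- The Jacobian |w|²/ω cancels the singularity M/|w|² of the integrand, leaving a multiple of |w|²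
+ ε = |w'|². A collision is a single value of x, hence negligible. -/
theorem IsRegularizedBy.jacobiLength_eq (h : IsRegularizedBy z T ω (M / E) a b X) (hω : 0 < ω)
    (hM : 0 < M) (hE : E = 2 * ω ^ 2) (harc : IsKeplerArc M E p₀ p₁ T z) :
    IntervalIntegrable (jacobiIntegrand M E T z) MeasureTheory.volume 0 T ∧
      jacobiLength M E T z = √2 * E / ω *
        ∫ x in (0 : ℝ)..X T, Complex.normSq (hyperbolicMotion b a x) := by
  have hE0 : 0 < E := by rw [hE]; positivity
  have hε : 0 < M / E := by positivity
  have hθ : 0 ≤ X T := h.map_zero hω hε ▸ (h.strictMono hω hε).monotone harc.pos.le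
  have himg := h.image_keplerTime hω hε
  have hmono := strictMono_keplerTime hω (h.lt hε)
  have hder : ∀ x ∈ Icc 0 (X T), HasDerivWithinAt (keplerTime a b ω)
      (Complex.normSq (hyperbolicMotion a b x) / ω) (Icc 0 (X T)) x := fun x _ =>
    (hasDerivAt_keplerTime a b ω x).hasDerivWithinAt
  have hc : Continuous fun x => √2 * E / ω * Complex.normSq (hyperbolicMotion b a x) :=
    continuous_const.mul (Complex.continuous_normSq.comp (continuous_hyperbolicMotion b a))
  have hnull : ∀ᵐ x ∂MeasureTheory.volume, hyperbolicMotion a b x ≠ 0 := by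
    have hs : {x | hyperbolicMotion a b x = 0}.Subsingleton := fun x hx y hy =>
      hyperbolicMotion_zero_unique (h.lt hε) hx hy
    filter_upwards [MeasureTheory.measure_eq_zero_iff_ae_notMem.1
      (hs.countable.measure_zero MeasureTheory.volume)] with x hx using hx
  have hae : (fun x => |Complex.normSq (hyperbolicMotion a b x) / ω| •
      jacobiIntegrand M E T z (keplerTime a b ω x)) =ᵐ[MeasureTheory.volume.restrict
        (Icc 0 (X T))] fun x => √2 * E / ω * Complex.normSq (hyperbolicMotion b a x) := by
    filter_upwards [MeasureTheory.ae_restrict_mem measurableSet_Icc,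
      MeasureTheory.ae_restrict_of_ae hnull] with x hx h0
    have hs : keplerTime a b ω x ∈ Icc 0 T := himg ▸ mem_image_of_mem _ hx
    have hXx : X (keplerTime a b ω x) = x := hmono.injective (h.time _)
    have hzx : z (keplerTime a b ω x) = complexPlane (hyperbolicMotion a b x ^ 2) := by
      rw [h.eqOn hs]; simp only [hXx]
    have hn := Complex.normSq_pos.2 h0
    rw [harc.jacobiIntegrand_eq hs (by rw [hzx]; simpa using h0) hM hE0, hzx,
      norm_complexPlane_sq, abs_of_pos (div_pos hn hω), smul_eq_mul]
    have he := normSq_hyperbolicMotion_sub a b x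
    rw [h.energy] at he
    have hMe : M = E * (M / E) := by field_simp
    rw [← he] at hMe
    rw [hMe]
    field_simp
    ring
  have hint : MeasureTheory.IntegrableOn (jacobiIntegrand M E T z) (Icc 0 T) := by
    rw [← himg, MeasureTheory.integrableOn_image_iff_integrableOn_abs_deriv_smul
      measurableSet_Icc hder hmono.injective.injOn]
    exact (hc.integrableOn_Icc).congr hae.symm
  refine ⟨(intervalIntegrable_iff_integrableOn_Icc_of_le harc.pos.le).2 hint, ?_⟩
  rw [jacobiLength, intervalIntegral.integral_of_le harc.pos.le,
    ← MeasureTheory.integral_Icc_eq_integral_Ioc, ← himg,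
    MeasureTheory.integral_image_eq_integral_abs_deriv_smul measurableSet_Icc hder
      hmono.injective.injOn, MeasureTheory.integral_congr_ae hae,
    ← intervalIntegral.integral_const_mul, intervalIntegral.integral_of_le hθ,
    MeasureTheory.integral_Icc_eq_integral_Ioc]

/-- The boundary terms of the Jacobi length, in terms of the end points. -/
theorem sinh_mul_boundary (a b : ℂ) (θ : ℝ) :
    Real.sinh θ * ((hyperbolicMotion a b θ).re * (hyperbolicMotion b a θ).re +
        (hyperbolicMotion a b θ).im * (hyperbolicMotion b a θ).im -
        (a.re * b.re + a.im * b.im)) =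
      Real.cosh θ * (Complex.normSq a + Complex.normSq (hyperbolicMotion a b θ)) -
        2 * (a.re * (hyperbolicMotion a b θ).re + a.im * (hyperbolicMotion a b θ).im) := by
  simp only [Complex.normSq_apply, hyperbolicMotion_re, hyperbolicMotion_im]
  have hs := Real.cosh_sq θ
  generalize Real.cosh θ = c at *
  generalize Real.sinh θ = s at *
  linear_combination (-(c * (a.re ^ 2 + a.im ^ 2)) - s * (a.re * b.re + a.im * b.im)) * hs

/-- The Jacobi length of a topologically non-trivial Kepler arc. -/
theorem IsKeplerArc.jacobiLength_eq (h : IsKeplerArc M E p₀ p₁ T z) (hM : 0 < M) (hE : 0 < E)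
    (hN : NonAntipodal p₀ p₁) (ht : TopologicallyNontrivial p₀ p₁ T z) :
    IntervalIntegrable (jacobiIntegrand M E T z) MeasureTheory.volume 0 T ∧
      jacobiLength M E T z = √E * (‖p₀‖ + ‖p₁‖) +
        M / √E * (lengthRemainder (M / E, p₀, p₁) - Real.log (M / (2 * E))) := by
  obtain ⟨a, ha⟩ := exists_complexPlane_sq p₀
  have ha0 : a ≠ 0 := by rintro rfl; exact hN.left_ne_zero (by simp [ha])
  have hε : 0 < M / E := by positivity
  have hω : 0 < √(E / 2) := by positivity
  have hEω : E = 2 * √(E / 2) ^ 2 := by rw [Real.sq_sqrt (by positivity)]; ring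
  obtain ⟨b, X, hr⟩ := h.exists_isRegularizedBy hM hω hEω ha ha0
  obtain ⟨hint, hlen⟩ := hr.jacobiLength_eq hω hM hEω h
  refine ⟨hint, ?_⟩
  have hm := (hr.topologicallyNontrivial_iff hω hε h.pos ha0 h.start h.finish hN).1 ht
  have hp₁ : p₁ = complexPlane (hyperbolicMotion a b (X T) ^ 2) :=
    h.finish.symm.trans (hr.eqOn ⟨h.pos.le, le_rfl⟩)
  have hθ : 0 < X T := hr.map_zero hω hε ▸ hr.strictMono hω hε h.pos
  have hg := mul_cosh_eq_arcCosh hε hr.energy hm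
  have hd := halfAngleTerm_complexPlane_sq a (hyperbolicMotion a b (X T))
  rw [abs_of_neg hm, ← ha, ← hp₁] at hd
  rw [← ha, ← hp₁] at hg
  have hS : 0 < Real.sinh (X T) := Real.sinh_pos_iff.2 hθ
  have hh : M / E * Real.sinh (X T) = arcSinh (M / E, p₀, p₁) := by
    rw [arcSinh, ← hg, ← Real.sqrt_sq (mul_pos hε hS).le]
    congr 1
    linear_combination (-(M / E) ^ 2) * Real.cosh_sq (X T)
  -- cosh θ + sinh θ = exp θ, so the argument of the first logarithm is ε exp θ / 2.
  have hlog : X T = Real.log ((arcCosh (M / E, p₀, p₁) + arcSinh (M / E, p₀, p₁)) / 2) -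
      Real.log (M / (2 * E)) := by
    have h1 : (arcCosh (M / E, p₀, p₁) + arcSinh (M / E, p₀, p₁)) / 2 =
        M / (2 * E) * Real.exp (X T) := by
      rw [← hg, ← hh, ← Real.cosh_add_sinh]; field_simp
    rw [h1, Real.log_mul (by positivity) (Real.exp_ne_zero _), Real.log_exp]
    ring
  have hbd := sinh_mul_boundary a b (X T)
  rw [← norm_complexPlane_sq, ← norm_complexPlane_sq, ← ha, ← hp₁] at hbd
  have hcoef : √2 * E / √(E / 2) = 2 * √E := by
    rw [Real.sqrt_div hE.le]
    have h2 : √(2 : ℝ) * √2 = 2 := Real.mul_self_sqrt (by norm_num)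
    have h3 : √E * √E = E := Real.mul_self_sqrt hE.le
    have h4 : 0 < √E := by positivity
    field_simp
    linear_combination E * h2 - 2 * h3
  rw [hlen, hcoef, integral_normSq_hyperbolicMotion hr.energy]
  rw [lengthRemainder]
  dsimp only
  rw [eq_add_of_sub_eq hlog.symm, hd]
  have hgpos : 0 < arcCosh (M / E, p₀, p₁) := by
    rw [← hg]; exact mul_pos hε (Real.cosh_pos _)
  have hC := Real.cosh_pos (X T)
  have hcs := Real.cosh_sq (X T)
  rw [← hg, ← hh]
  set B := (hyperbolicMotion a b (X T)).re * (hyperbolicMotion b a (X T)).re +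
        (hyperbolicMotion a b (X T)).im * (hyperbolicMotion b a (X T)).im -
        (a.re * b.re + a.im * b.im)
  set m := a.re * (hyperbolicMotion a b (X T)).re + a.im * (hyperbolicMotion a b (X T)).im
  have hB : B = (Real.cosh (X T) * (‖p₀‖ + ‖p₁‖) - 2 * m) / Real.sinh (X T) := by
    rw [← hbd]; field_simp
  rw [hB]
  have h3 : √E ^ 2 = E := Real.sq_sqrt hE.le
  have h4 : 0 < √E := by positivity
  generalize Real.cosh (X T) = c at *
  generalize Real.sinh (X T) = s at *
  generalize √E = q at *
  generalize Real.log (M / (2 * E)) = l at *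
  subst h3
  have hcs' : 0 < c + s := by positivity
  field_simp
  -- This is coth θ - 1 = 1 / (sinh θ (cosh θ + sinh θ)), the source of the first term of
  -- `lengthRemainder`.
  linear_combination (q ^ 2 * (‖p₀‖ + ‖p₁‖)) * hcs

end Length

/-! ### Conclusion -/

theorem mainTheorem9 (M : ℝ) (hM : 0 < M) :
    (∀ p₀ p₁ : Plane, NonAntipodal p₀ p₁ → ∀ E : ℝ, 0 < E →
      ∃ (T : ℝ) (z : ℝ → Plane),
        (IsKeplerArc M E p₀ p₁ T z ∧ TopologicallyNontrivial p₀ p₁ T z) ∧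
        ∀ (T' : ℝ) (z' : ℝ → Plane),
          IsKeplerArc M E p₀ p₁ T' z' → TopologicallyNontrivial p₀ p₁ T' z' →
            T' = T ∧ EqOn z' z (Icc 0 T)) ∧
    ∃ F : ℝ → Plane × Plane → ℝ,
      (∀ p₀ p₁ : Plane, NonAntipodal p₀ p₁ → ∀ E : ℝ, 0 < E →
        ∀ (T : ℝ) (z : ℝ → Plane),
          IsKeplerArc M E p₀ p₁ T z → TopologicallyNontrivial p₀ p₁ T z →
            IntervalIntegrable (jacobiIntegrand M E T z) MeasureTheory.volume 0 T ∧
            jacobiLength M E T z =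
              √E * (‖p₀‖ + ‖p₁‖) + M / √E * (F E (p₀, p₁) - Real.log (M / (2 * E)))) ∧
      (∀ E : ℝ, 0 < E → ContDiffOn ℝ 2 (F E) nonAntipodalPairs) ∧
      (∀ K : Set (Plane × Plane), IsCompact K → K ⊆ nonAntipodalPairs →
        ∃ (C E₀ : ℝ), 0 < E₀ ∧ ∀ E : ℝ, E₀ ≤ E → ∀ x ∈ K, ∀ k : ℕ, k ≤ 2 →
          ‖iteratedFDeriv ℝ k (F E) x‖ ≤ C) := by
  refine ⟨fun p₀ p₁ hN E hE => ?_, fun E x => lengthRemainder (M / E, x),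
    fun p₀ p₁ hN E hE T z h ht => h.jacobiLength_eq hM hE hN ht, fun E hE x hx => ?_,
    fun K hK hKN => ?_⟩
  · obtain ⟨T, z, h, ht⟩ := exists_nontrivial_keplerArc hM hE hN
    exact ⟨T, z, ⟨h, ht⟩, fun T' z' h' ht' => nontrivial_keplerArc_unique hM hE hN h ht h' ht'⟩
  · have h1 := contDiffAt_lengthRemainder (y := (M / E, x)) (by positivity) hx
    exact (h1.comp x (contDiffAt_const.prodMk contDiffAt_id)).contDiffWithinAt
  · obtain ⟨C, hC⟩ := exists_bound_norm_iteratedFDeriv_prodMk (n := 2) (isCompact_Icc (a := (0 : ℝ))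
      (b := 1)) hK fun t ht x hx => contDiffAt_lengthRemainder (y := (t, x)) ht.1 (hKN hx)
    -- The choice E₀ = M puts ε = M/E in [0, 1].
    refine ⟨C, M, hM, fun E hE x hx k hk => hC (M / E) ⟨?_, ?_⟩ x hx k hk⟩
    · have := hM.trans_le hE
      positivity
    · exact (div_le_one (hM.trans_le hE)).2 hE
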